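/- Let $F$ be a field of characteristic $3$. An \emph{algebra of type 2} over $F$ is an (infinite-dimensional) Lie algebra $L=\bigoplus_{i\ge 1}L_i$ over $F$, graded over the positive integers, with $\dim L_i=1$ for all $i\ge 1$, generated by $L_1$ and $L_2$, and of maximal class, i.e. the Lie power $L^n$ has codimension $n$ for every $n\ge 2$. Given non-zero $e_1\in L_1$, $e_2\in L_2$, put $e_{i+1}=[e_i,e_1]$ for $i\ge 2$. (1) For each $\lambda\in F$ let $L(\lambda)$ be the Lie algebra over $F$ (with bracket $[A,B]=AB-BA$) generated by the following $4\times 4$ matrices over the field $F(t)$ of rational functions: $$e_1=\begin{bmatrix}0&1&0&0\\0&0&1&0\\t&0&0&0\\0&0&0&0\end{bmatrix},\qquad e_2=\begin{bmatrix}0&0&1&0\\\lambda t&0&0&0\\0&-(1+\lambda)t&0&0\\0&1/t&0&0\end{bmatrix},$$ and define $e_{i+1}=[e_i,e_1]$ for $i\ge 2$. Then $L(\lambda)$ is infinite-dimensional and soluble, the $e_i$ $(i\ge 1)$ form an $F$-basis of it, and with $e_i$ spanning the component of weight $i$ it is an algebra of type 2. It satisfies $$[e_i,e_1]=e_{i+1}\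 (i\ge 2),\qquad [e_3,e_2]=e_5,$$ $$[e_{3k+1},e_2]=e_{3k+3},\quad [e_{3k+2},e_2]=\lambda e_{3k+4},\quad [e_{3k+3},e_2]=(-1-\lambda)e_{3k+5}\quad (k\ge 1),$$ $$[e_k,e_3]=(1-\lambda)e_{k+3}\ (k\ge 4),\qquad [e_k,e_m]=0\ (k,m\ge 4).$$ Explicitly, $e_3$ has diagonal entries $(1-\lambda)t,(1-\lambda)t,(1-\lambda)t,0$, entry $1/t$ in position $(4,3)$ and zeros elsewhere; and for $j\ge 0$, $1\le k\le 3$, the only non-zero entry of $e_{3(j+1)+k}$ is $t^j$ in position $(4,k)$. (2) For each $\lambda\in F$ (including $\lambda=0$ and $\lambda=-1$), $L(\lambda)$ is the unique algebra of type 2 over $F$ with $[e_3,e_2]=e_5$ and $[e_5,e_2]=\lambda e_7$: if $L$ is any algebra of type 2 over $F$ for which non-zero $e_1\in L_1$, $e_2\in L_2$ satisfy these two relations, then the $e_i$ in $L$ satisfy all the relations displayed above, and there is an isomorphism of graded Lie algebras $L\to L(\lambda)$ mapping each $e_i$ to $e_i$. (3) If $L$ is any algebra of type 2 over $F$ and $e_1\in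 L_1$, $e_2\in L_2$ satisfy $[e_3,e_2]\ne 0$, then after replacing $e_2$ by a suitable non-zero scalar multiple one has $[e_3,e_2]=e_5$ and $[e_5,e_2]=\lambda e_7$ for some $\lambda\in F$. -/

import Mathlib

/-- A Lie algebra `L` over `F` is of maximal class (infinite-dimensional sense): for every `n ≥ 2`
the `n`-th Lie power `L^n` has codimension `n`. Mathlib's `lowerCentralSeries F L L k` is the Lie
power `L^(k+1)`. -/
def IsMaximalClass (F L : Type*) [Field F] [LieRing L] [LieAlgebra F L] : Prop :=
  ∀ k : ℕ, 1 ≤ k → Module.finrank F (L ⧸ LieModule.lowerCentralSeries F L L k) = k + 1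

/-- `L = ⨁_{i ≥ 1} ℒ i` is an (infinite-dimensional) algebra of type 2: a Lie algebra of maximal
class graded over the positive integers, all of whose components are one-dimensional, and which is
generated by the components of weight one and two. -/
structure IsTypeTwo {F L : Type*} [Field F] [LieRing L] [LieAlgebra F L]
    (ℒ : ℕ → Submodule F L) : Prop where
  graded : Nonempty (GradedLieAlgebra ℒ)
  zero_eq_bot : ℒ 0 = ⊥
  finrank_eq_one : ∀ i : ℕ, 1 ≤ i → Module.finrank F (ℒ i) = 1
  generated : LieSubalgebra.lieSpan F L ((ℒ 1 : Set L) ∪ (ℒ 2 : Set L)) = ⊤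
  maximalClass : IsMaximalClass F L

/-- The elements `e_i`, `i ≥ 1`, determined by `e_1`, `e_2` and `e_{i+1} = [e_i, e_1]` for `i ≥ 2`
(the value at `0` is the dummy `0`). -/
def weightSeq {L : Type*} [LieRing L] (e₁ e₂ : L) : ℕ → L
  | 0 => 0
  | 1 => e₁
  | 2 => e₂
  | n + 3 => ⁅weightSeq e₁ e₂ (n + 2), e₁⁆

/-- The multiplication table of the algebra with parameter `lam`. -/
structure HasTable {F L : Type*} [Field F] [LieRing L] [LieAlgebra F L]
    (lam : F) (e : ℕ → L) : Prop where
  lie_one : ∀ i : ℕ, 2 ≤ i → ⁅e i, e 1⁆ = e (i + 1)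
  lie_three_two : ⁅e 3, e 2⁆ = e 5
  lie_two_of_one_mod : ∀ k : ℕ, 1 ≤ k → ⁅e (3 * k + 1), e 2⁆ = e (3 * k + 3)
  lie_two_of_two_mod : ∀ k : ℕ, 1 ≤ k → ⁅e (3 * k + 2), e 2⁆ = lam • e (3 * k + 4)
  lie_two_of_zero_mod : ∀ k : ℕ, 1 ≤ k → ⁅e (3 * k + 3), e 2⁆ = (-1 - lam) • e (3 * k + 5)
  lie_three : ∀ k : ℕ, 4 ≤ k → ⁅e k, e 3⁆ = (1 - lam) • e (k + 3)
  lie_eq_zero : ∀ k m : ℕ, 4 ≤ k → 4 ≤ m → ⁅e k, e m⁆ = 0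

/- The commutator bracket `⁅A, B⁆ = A * B - B * A` on matrices. -/
attribute [local instance 100] LieRing.ofAssociativeRing

section Construction

open RatFunc

/-- The matrix `e_1` over `F(t)`. -/
noncomputable def matE (F : Type*) [Field F] : Matrix (Fin 4) (Fin 4) (RatFunc F) :=
  !![0, 1, 0, 0;
     0, 0, 1, 0;
     X, 0, 0, 0;
     0, 0, 0, 0]

/-- The matrix `e_2` over `F(t)`. -/
noncomputable def matD {F : Type*} [Field F] (lam : F) : Matrix (Fin 4) (Fin 4) (RatFunc F) :=
  !![0, 0, 1, 0;
     C lam * X, 0, 0, 0;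
     0, -(1 + C lam) * X, 0, 0;
     0, 1 / X, 0, 0]

/-- The Lie algebra over `F` generated by the two matrices (under the commutator bracket). -/
noncomputable def extraAlgebra {F : Type*} [Field F] (lam : F) :
    LieSubalgebra F (Matrix (Fin 4) (Fin 4) (RatFunc F)) :=
  LieSubalgebra.lieSpan F (Matrix (Fin 4) (Fin 4) (RatFunc F)) {matE F, matD lam}

/-- The elements `e_i` of the matrix Lie algebra. -/
noncomputable def extraSeq {F : Type*} [Field F] (lam : F) : ℕ → extraAlgebra lam :=
  weightSeq
    (⟨matE F, LieSubalgebra.subset_lieSpan (Set.mem_insert _ _)⟩ : extraAlgebra lam)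
    (⟨matD lam, LieSubalgebra.subset_lieSpan (Set.mem_insert_of_mem _ rfl)⟩ : extraAlgebra lam)

/-- The grading of the matrix Lie algebra in which `e_i` spans the component of weight `i`. -/
noncomputable def extraGrading {F : Type*} [Field F] (lam : F) (i : ℕ) :
    Submodule F (extraAlgebra lam) :=
  Submodule.span F {extraSeq lam i}

end Construction

/-! Maximal class forces `[e_n, e_1] ≠ 0` for `n ≥ 2` (`lie_one_ne_zero`), so in an algebra of type
2 the `e_i` form a graded basis, and the whole bracket is encoded in the scalars `a_i` with `[e_i,
e_2] = a_i e_{i+2}`. With S the shift of sequences, `[e_i, e_{j+2}]` has coefficient `((1 - S)^j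
a)_i` for `i ≥ 2`. Antisymmetry and Jacobi become identities on `a` (`IsStructureSeq`), tractable in
characteristic 3 because (1 - S)^q = 1 - S^q for q = 3^r.

One Jacobi identity (`rec_three`) gives `a_{i+3}` from the three preceding terms and propagates the
pattern 1, λ, -1-λ (`periodic`), except that it is vacuous at one residue class mod 3 when λ = 0 or
λ = -1. In these two cases suppose that the pattern first breaks at N. Further identities leave a
single possible wrong value, after which the pattern runs on out of phase for about q places, where
q is the exact power of 3 dividing N - 1, respectively N - 3. Antisymmetry of `[e_N, e_{q+2}]` then
forces 3 to divide the cofactor, a contradiction (`lamZero_aux`, `lamNegOne_aux`).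

Periodicity makes the differences of consecutive `a_i` constant from index 4 on, so second
differences vanish and the `e_i` with `i ≥ 4` commute. This yields the table
(`IsGradedBasis.hasTable`), which determines the algebra (`exists_lieEquiv`). Existence is a
computation with matrices whose fourth column is zero, acting from the right on fourth rows
(`hasTable_mat`); a map to monomials gives independence. -/

/-- The negated forward difference operator on sequences. -/
def backDiff {F : Type*} [Ring F] (a : ℕ → F) (i : ℕ) : F := a i - a (i + 1)

/-! ### Powers of the difference operator in characteristic 3 -/

section BackDiff

variable {F : Type*} [Field F]

/-- Iterates of `backDiff` at a place from which the sequence vanishes, except at the far end. -/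
lemma backDiff_iterate_of_eq_zero {a : ℕ → F} {n i : ℕ} (h : ∀ k < n, a (i + k) = 0) :
    backDiff^[n] a i = (-1) ^ n * a (i + n) := by
  induction n generalizing i with
  | zero => simp
  | succ n ih =>
    rw [Function.iterate_succ_apply', backDiff, ih fun k hk => h k (by omega),
      ih (i := i + 1) fun k hk => by
        have := h (k + 1) (by omega)
        rwa [← add_assoc, add_right_comm] at this, h n (by omega)]
    rw [add_right_comm, add_assoc i n 1]
    ring

/-- Iterates of the difference operator with step `q`, applied to a sequence that is constant
except at the last two places. -/
lemma iterate_stepDiff {U : (ℕ → F) → ℕ → F} {q : ℕ} (hU : ∀ b i, U b i = b i - b (i + q))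
    (c : F) (h : ℕ → F) (m i : ℕ) (hc : ∀ k < m, h (i + k * q) = c) :
    U^[m + 1] h i =
      (-1) ^ m * ((m + 1) * (h (i + m * q) - c) - (h (i + (m + 1) * q) - c)) := by
  -- In the binomial expansion of (1 - S^q)^(m+1) applied to h - c only the last two terms survive,
  -- with coefficients (-1)^m (m+1) and -(-1)^m.
  induction m generalizing i with
  | zero => simp [hU]
  | succ m ih =>
    rw [Function.iterate_succ_apply', hU, ih i fun k hk => hc k (by omega),
      ih (i + q) fun k hk => by
        have := hc (k + 1) (by omega)
        rwa [add_mul, one_mul, add_comm (k * q), ← add_assoc] at this]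
    have h1 : i + q + m * q = i + (m + 1) * q := by ring
    have h2 : i + q + (m + 1) * q = i + (m + 1 + 1) * q := by ring
    rw [h1, h2, hc m (by omega)]
    push_cast
    ring

variable [CharP F 3]

lemma three_eq_zero_of_charP : (3 : F) = 0 := by
  exact_mod_cast CharP.cast_eq_zero F 3

lemma backDiff_iterate_two (a : ℕ → F) (i : ℕ) :
    backDiff^[2] a i = a i + a (i + 1) + a (i + 2) := by
  have h3 : (3 : F) = 0 := three_eq_zero_of_charP
  simp only [Function.iterate_succ, Function.iterate_zero, Function.comp, backDiff, id]
  linear_combination (-a (i + 1)) * h3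

/-- Frobenius for the operator 1 - S, where S is the shift. -/
lemma backDiff_iterate_pow_three (r : ℕ) (a : ℕ → F) (i : ℕ) :
    backDiff^[3 ^ r] a i = a i - a (i + 3 ^ r) := by
  induction r generalizing a i with
  | zero => simp [backDiff]
  | succ r ih =>
    have h3 : (3 : F) = 0 := three_eq_zero_of_charP
    rw [pow_succ, Function.iterate_mul]
    simp only [Function.iterate_succ, Function.iterate_zero, Function.comp, id, ih]
    have e1 : i + 3 ^ r + 3 ^ r = i + 2 * 3 ^ r := by ring
    have e2 : i + 2 * 3 ^ r + 3 ^ r = i + 3 ^ r * 3 := by ring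
    rw [e1, e2]
    linear_combination (a (i + 2 * 3 ^ r) - a (i + 3 ^ r)) * h3

/-- With q = 3^r this is (1 - S)^(q-1) = (1 - S^q)/(1 - S) = 1 + S + ... + S^(q-1). The induction
multiplies by (1 - S^q)^2 = 1 + S^q + S^(2q). -/
lemma backDiff_iterate_pow_three_sub_one (r : ℕ) (a : ℕ → F) (i : ℕ) :
    backDiff^[3 ^ r - 1] a i = ∑ k ∈ Finset.range (3 ^ r), a (i + k) := by
  induction r generalizing i with
  | zero => simp
  | succ r ih =>
    have h3 : (3 : F) = 0 := three_eq_zero_of_charP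
    have hq : 1 ≤ 3 ^ r := Nat.one_le_pow _ _ (by norm_num)
    have e : 3 ^ (r + 1) - 1 = 3 ^ r * 2 + (3 ^ r - 1) := by rw [pow_succ]; omega
    rw [e, Function.iterate_add_apply, Function.iterate_mul]
    simp only [Function.iterate_succ, Function.iterate_zero, Function.comp, id,
      backDiff_iterate_pow_three, ih]
    have e' : 3 ^ (r + 1) = 3 ^ r + 3 ^ r + 3 ^ r := by ring
    rw [e', Finset.sum_range_add, Finset.sum_range_add]
    simp only [add_assoc]
    linear_combination (-∑ x ∈ Finset.range (3 ^ r), a (i + (3 ^ r + x))) * h3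

end BackDiff

/-! ### Structure sequences and their recurrences -/

/-- The conditions on a sequence `a` which express that the brackets determined by
`[e_i, e_2] = a_i e_{i+2}` and `[e_i, e_1] = e_{i+1}` (for `i ≥ 2`) satisfy antisymmetry and the
Jacobi identity. -/
structure IsStructureSeq {F : Type*} [Field F] (a : ℕ → F) : Prop where
  anti : ∀ i j : ℕ, backDiff^[j] a (i + 2) + backDiff^[i] a (j + 2) = 0
  jacobi : ∀ m n i : ℕ, backDiff^[n] a (m + 2) * backDiff^[m + n + 2] a (i + 2) =
    backDiff^[m] a (i + 2) * backDiff^[n] a (i + m + 4) -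
      backDiff^[n] a (i + 2) * backDiff^[m] a (i + n + 4)

namespace IsStructureSeq

variable {F : Type*} [Field F] [CharP F 3] {a : ℕ → F}

/-- Jacobi for `e_i`, `e_3`, `e_2`. It determines `a l` unless `a i + a j = 1`; on the pattern 1, λ,
-1-λ this degeneracy occurs only for λ = 0 (at i ≡ 1 mod 3) and λ = -1 (at i ≡ 0). Indices are tied
by equations so that any arithmetic form of them can be supplied. -/
lemma rec_three (ha : IsStructureSeq a) (h3 : a 3 = 1) {i j k l : ℕ} (hi : 2 ≤ i)
    (hj : j = i + 1) (hk : k = i + 2) (hl : l = i + 3) :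
    a l * (1 - a i - a j) = a i * (1 + a k) := by
  subst hj hk hl
  obtain ⟨i, rfl⟩ := Nat.exists_eq_add_of_le' hi
  have h := ha.jacobi 1 0 i
  have e : backDiff^[3] a (i + 2) = a (i + 2) - a (i + 2 + 3) :=
    backDiff_iterate_pow_three 1 a (i + 2)
  simp only [Function.iterate_zero, id, Nat.reduceAdd, h3, e, Function.iterate_one, backDiff,
    add_zero] at h
  simp only [add_assoc, Nat.reduceAdd] at h ⊢
  linear_combination -h - a (i + 5) * a (i + 2) * three_eq_zero_of_charP (F := F)

/-- Jacobi for `e_i`, `e_{q+2}`, `e_2` with q = 3^r, using (1 - S)^(q+2) = (1 - S^q)(1 + S + S^2).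
It compares three consecutive terms with those q places further on, and so fills the gaps where
`rec_three` is degenerate. -/
lemma rec_pow (ha : IsStructureSeq a) (r : ℕ) {i i₁ i₂ j j₁ j₂ : ℕ} (hi : 2 ≤ i)
    (hi₁ : i₁ = i + 1) (hi₂ : i₂ = i + 2) (hj : j = i + 3 ^ r) (hj₁ : j₁ = j + 1)
    (hj₂ : j₂ = j + 2) :
    a (3 ^ r + 2) * (a i + a i₁ + a i₂ - (a j + a j₁ + a j₂)) =
      (a i - a j) * a j₂ - a i * (a i₂ - a j₂) := by
  subst hj₁ hj₂ hi₁ hi₂ hj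
  obtain ⟨i, rfl⟩ := Nat.exists_eq_add_of_le' hi
  have h := ha.jacobi (3 ^ r) 0 i
  have e : backDiff^[3 ^ r + 0 + 2] a (i + 2) =
      (a (i + 2) + a (i + 2 + 1) + a (i + 2 + 2)) -
      (a (i + 2 + 3 ^ r) + a (i + 2 + 3 ^ r + 1) + a (i + 2 + 3 ^ r + 2)) := by
    rw [add_zero, Function.iterate_add_apply, backDiff_iterate_pow_three, backDiff_iterate_two,
      backDiff_iterate_two]
  rw [e] at h
  simp only [backDiff_iterate_pow_three, Function.iterate_zero, id] at h
  have e1 : i + 0 + 4 = i + 2 + 2 := by ring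
  have e2 : i + 3 ^ r + 4 = i + 2 + 3 ^ r + 2 := by ring
  have e3 : i + 2 + 2 + 3 ^ r = i + 2 + 3 ^ r + 2 := by ring
  rw [e1, e2, e3] at h
  exact h

/-- Jacobi for `e_i`, `e_4`, `e_5`: the coefficient of `[e_4, e_5]` is `a 4 - a 7 = 0`, which kills
one of the three terms, and `h0` kills another. -/
lemma rec_four_five (ha : IsStructureSeq a) (h47 : a 4 = a 7) {i : ℕ} (hi : 2 ≤ i)
    (h0 : a i + a (i + 1) + a (i + 2) = 0) (hne : a i ≠ a (i + 3)) :
    a (i + 5) + a (i + 6) + a (i + 7) = 0 := by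
  obtain ⟨i, rfl⟩ := Nat.exists_eq_add_of_le' hi
  have h := ha.jacobi 2 3 i
  have e (i : ℕ) : backDiff^[3] a i = a i - a (i + 3) := backDiff_iterate_pow_three 1 a i
  simp only [e, backDiff_iterate_two, Nat.reduceAdd, h47] at h
  rw [h0] at h
  have h' : (a (i + 2) - a (i + 2 + 3)) * (a (i + 2 + 5) + a (i + 2 + 6) + a (i + 2 + 7)) = 0 := by
    simp only [add_assoc, Nat.reduceAdd] at h ⊢
    linear_combination h
  exact (mul_eq_zero.mp h').resolve_left (sub_ne_zero.mpr hne)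

/-- The first place at which three consecutive terms do not add up to zero is odd. -/
lemma sum_three_eq_zero_of_even (ha : IsStructureSeq a) {n : ℕ} (hn : Even n)
    (h : ∀ k < n, a (k + 4) + a (k + 5) + a (k + 6) = 0) :
    a (n + 4) + a (n + 5) + a (n + 6) = 0 := by
  -- The difference of order n + 2 is an n-th difference of sums of three consecutive terms; it
  -- reduces to (-1)^n times the last such sum. For even n antisymmetry says that twice this sum is
  -- zero.
  have h1 := ha.anti 2 (n + 2)
  rw [Function.iterate_add_apply, backDiff_iterate_of_eq_zero, hn.neg_one_pow, one_mul] at h1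
  · simp only [backDiff_iterate_two] at h1
    have h3 : (3 : F) = 0 := three_eq_zero_of_charP
    have e : 2 + 2 + n = n + 2 + 2 := by ring
    rw [e] at h1
    simp only [add_assoc, Nat.reduceAdd] at h1 ⊢
    linear_combination (-1 : F) * h1 + (a (n + 4) + (a (n + 5) + a (n + 6))) * h3
  · intro k hk
    rw [backDiff_iterate_two, ← h k hk]
    congr 2 <;> ring_nf

/-! ### The degenerate parameter λ = 0 -/

section LamZero

variable {N : ℕ}

/-- Initial pattern `1, 0, -1` followed by a deviating term `a N`. -/
lemma lamZero_next (ha : IsStructureSeq a) (h3 : a 3 = 1) (hN : 7 ≤ N) (hN3 : N % 3 = 1)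
    (p2 : ∀ i, 4 ≤ i → i < N → i % 3 = 2 → a i = 0)
    (p0 : ∀ i, 4 ≤ i → i < N → i % 3 = 0 → a i = -1) :
    a (N + 1) = 0 ∧ a (N + 2) * (a N + 1) = 1 := by
  have t : (3 : F) = 0 := three_eq_zero_of_charP
  have r1 := ha.rec_three h3 (i := N - 2) (j := N - 1) (k := N) (l := N + 1)
    (by omega) (by omega) (by omega) (by omega)
  have r2 := ha.rec_three h3 (i := N - 1) (j := N) (k := N + 1) (l := N + 2)
    (by omega) (by omega) (by omega) (by omega)
  rw [p2 (N - 2) (by omega) (by omega) (by omega), p0 (N - 1) (by omega) (by omega) (by omega)]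
    at r1
  rw [p0 (N - 1) (by omega) (by omega) (by omega)] at r2
  have h1 : a (N + 1) = 0 := by linear_combination -r1 + a (N + 1) * t
  refine ⟨h1, ?_⟩
  rw [h1] at r2
  linear_combination -r2 + a (N + 2) * t

/-- A value `a N ≠ 1` makes the later recurrences nondegenerate, and together they leave only `a N =
0`. From `N + 2` on the pattern 1, 0, -1 then starts again, out of phase. -/
lemma lamZero_eq_one_or_eq_zero (ha : IsStructureSeq a) (h3 : a 3 = 1) (hN : 7 ≤ N)
    (hN3 : N % 3 = 1)
    (p1 : ∀ i, 4 ≤ i → i < N → i % 3 = 1 → a i = 1)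
    (p2 : ∀ i, 4 ≤ i → i < N → i % 3 = 2 → a i = 0)
    (p0 : ∀ i, 4 ≤ i → i < N → i % 3 = 0 → a i = -1) :
    a N = 1 ∨ (10 ≤ N ∧ a N = 0 ∧ a (N + 2) = 1 ∧ a (N + 3) = 0 ∧ a (N + 4) = -1) := by
  have t : (3 : F) = 0 := three_eq_zero_of_charP
  obtain ⟨h1, h2⟩ := ha.lamZero_next h3 hN hN3 p2 p0
  have r3 := ha.rec_three h3 (i := N) (j := N + 1) (k := N + 2) (l := N + 3)
    (by omega) (by omega) (by omega) (by omega)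
  have r4 := ha.rec_three h3 (i := N + 1) (j := N + 2) (k := N + 3) (l := N + 4)
    (by omega) (by omega) (by omega) (by omega)
  rw [h1] at r3 r4
  have hx1 : a N + 1 ≠ 0 := fun h => by rw [h, mul_zero] at h2; exact zero_ne_one h2
  by_cases hx : a N = 1
  · exact Or.inl hx
  have hx' : a N - 1 ≠ 0 := sub_ne_zero.mpr hx
  rcases Nat.lt_or_ge N 10 with h10 | h10
  · obtain rfl : N = 7 := by omega
    left
    -- For N = 7 the equality `a 4 = a 7` is itself in question, so `rec_four_five` is replaced by
    -- antisymmetry of `[e_7, e_5]`.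
    have h := ha.anti 5 3
    have e1 : backDiff^[3] a (5 + 2) = a 7 - a 10 := backDiff_iterate_pow_three 1 a 7
    have e2 : backDiff^[5] a (3 + 2) = a 5 - a 8 + (a 6 - a 9) + (a 7 - a 10) := by
      have := backDiff_iterate_two (backDiff^[3] a) 5
      rw [← Function.iterate_add_apply] at this
      refine this.trans ?_
      have e (i : ℕ) : backDiff^[3] a i = a i - a (i + 3) := backDiff_iterate_pow_three 1 a i
      simp only [e, Nat.reduceAdd]
    rw [e1, e2, p2 5 (by omega) (by omega) (by omega), p0 6 (by omega) (by omega) (by omega)] at h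
    norm_num at r3 h1 h2
    rw [h1] at h
    have key : (a 7 - 1) * ((a 7 - 1) * (a 7 + 1)) = 0 := by
      have h10' : a 10 = a 7 + 1 + a 9 := by linear_combination h + (a 10 - a 7) * t
      rw [h10'] at r3
      linear_combination -(a 7 + 1) * r3 + (1 - 2 * a 7) * h2 +
        (1 - a 7 - a 7 ^ 2) * t
    rcases mul_eq_zero.mp key with h | h
    · exact sub_eq_zero.mp h
    · exact (mul_eq_zero.mp h).elim sub_eq_zero.mp fun h => absurd h hx1
  · right
    have h47 : a 4 = a 7 := by
      rw [p1 4 (by omega) (by omega) (by omega), p1 7 (by omega) (by omega) (by omega)]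
    have h5 := ha.rec_four_five h47 (i := N - 3) (by omega)
      (by rw [p1 _ (by omega) (by omega) (by omega), p2 _ (by omega) (by omega) (by omega),
        p0 _ (by omega) (by omega) (by omega)]; ring)
      (by rw [p1 _ (by omega) (by omega) (by omega), show N - 3 + 3 = N by omega]
          exact fun h => hx h.symm)
    rw [show N - 3 + 5 = N + 2 by omega, show N - 3 + 6 = N + 3 by omega,
      show N - 3 + 7 = N + 4 by omega] at h5
    have h6 : a (N + 3) = -(a N * a (N + 2)) := by
      have : (a N - 1) * (a (N + 3) + a N * a (N + 2)) = 0 := by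
        linear_combination -r3 + a N * h2 - a N * a (N + 2) * t
      exact eq_neg_of_add_eq_zero_left ((mul_eq_zero.mp this).resolve_left hx')
    have hx0 : a N = 0 := by
      by_contra hx0
      have h7 : a (N + 4) = 0 := by
        have : (a N * a (N + 2)) * a (N + 4) = 0 := by linear_combination r4 + a (N + 4) * h2
        refine (mul_eq_zero.mp this).resolve_left (mul_ne_zero hx0 fun h => ?_)
        rw [h, zero_mul] at h2
        exact zero_ne_one h2
      rw [h6, h7] at h5
      have : a (N + 2) * (a N - 1) = 0 := by linear_combination -h5
      rcases mul_eq_zero.mp this with h | h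
      · rw [h, zero_mul] at h2
        exact zero_ne_one h2
      · exact hx' h
    have h2' : a (N + 2) = 1 := by rw [hx0] at h2; simpa using h2
    rw [hx0, zero_mul, neg_zero] at h6
    refine ⟨h10, hx0, h2', h6, ?_⟩
    rw [h2', h6] at h5
    linear_combination h5

/-- In the shifted pattern `rec_three` is degenerate exactly where the next 1 is due. There
`rec_pow` is used: q = 3^r places earlier the sequence is still regular, and `a (q + 2) = 0`. The
bound on `s` keeps these earlier places below `N`. -/
lemma lamZero_tail (ha : IsStructureSeq a) (h3 : a 3 = 1) {r m : ℕ} (hr : 1 ≤ r) (hm : 2 ≤ m)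
    (hNm : N = 3 ^ r * m + 1)
    (p1 : ∀ i, 4 ≤ i → i < N → i % 3 = 1 → a i = 1)
    (p2 : ∀ i, 4 ≤ i → i < N → i % 3 = 2 → a i = 0)
    (p0 : ∀ i, 4 ≤ i → i < N → i % 3 = 0 → a i = -1)
    (t2 : a (N + 2) = 1) (t3 : a (N + 3) = 0) (t4 : a (N + 4) = -1) (s : ℕ)
    (hs : 3 * (s + 1) ≤ 3 ^ r) :
    a (N + 2 + 3 * s) = 1 ∧ a (N + 3 + 3 * s) = 0 ∧ a (N + 4 + 3 * s) = -1 := by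
  have t : (3 : F) = 0 := three_eq_zero_of_charP
  obtain ⟨q', hq'⟩ : 3 ∣ 3 ^ r := dvd_pow_self 3 (by omega)
  have hqm : 3 ^ r * 2 ≤ 3 ^ r * m := Nat.mul_le_mul_left _ hm
  have hN3 : N % 3 = 1 := by rw [hNm, hq', mul_assoc]; omega
  induction s with
  | zero => exact ⟨t2, t3, t4⟩
  | succ s ih =>
    obtain ⟨u2, u3, u4⟩ := ih (by omega)
    have e1 := ha.rec_pow r (i := N + 3 + 3 * s - 3 ^ r) (j := N + 3 + 3 * s)
      (j₁ := N + 4 + 3 * s) (j₂ := N + 5 + 3 * s) (by omega) rfl rfl (by omega) (by omega)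
      (by omega)
    rw [p2 (3 ^ r + 2) (by omega) (by omega) (by omega), p1 (N + 3 + 3 * s - 3 ^ r) (by omega)
      (by omega) (by omega), p0 (N + 3 + 3 * s - 3 ^ r + 2) (by omega) (by omega) (by omega),
      u3, u4] at e1
    have v2 : a (N + 5 + 3 * s) = 1 := by
      linear_combination e1 + (a (N + 5 + 3 * s)) * t
    have e2 := ha.rec_three h3 (i := N + 3 + 3 * s) (j := N + 4 + 3 * s) (k := N + 5 + 3 * s)
      (l := N + 6 + 3 * s) (by omega) (by omega) (by omega) (by omega)
    have e3 := ha.rec_three h3 (i := N + 4 + 3 * s) (j := N + 5 + 3 * s) (k := N + 6 + 3 * s)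
      (l := N + 7 + 3 * s) (by omega) (by omega) (by omega) (by omega)
    rw [u3, u4, v2] at e2
    have v3 : a (N + 6 + 3 * s) = 0 := by
      linear_combination -e2 + a (N + 6 + 3 * s) * t
    rw [u4, v2, v3] at e3
    have v4 : a (N + 7 + 3 * s) = -1 := by linear_combination e3
    refine ⟨?_, ?_, ?_⟩
    · rw [← v2]; congr 1; ring
    · rw [← v3]; congr 1; ring
    · rw [← v4]; congr 1; ring

end LamZero

end IsStructureSeq

lemma Finset.sum_range_three_mul {M : Type*} [AddCommMonoid M] (b : ℕ → M) (n : ℕ) :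
    ∑ k ∈ Finset.range (3 * n), b k =
      ∑ j ∈ Finset.range n, (b (3 * j) + b (3 * j + 1) + b (3 * j + 2)) := by
  induction n with
  | zero => simp
  | succ n ih =>
    rw [Finset.sum_range_succ, ← ih, mul_add, mul_one, Finset.sum_range_succ,
      Finset.sum_range_succ, Finset.sum_range_succ]
    simp only [add_assoc]

namespace IsStructureSeq

variable {F : Type*} [Field F] [CharP F 3] {a : ℕ → F} {N : ℕ}

/-- If `a N ≠ 1`, parity makes N odd. Writing N - 1 = q m with q = 3^r and 3 ∤ m, antisymmetry of
`[e_N, e_{q+2}]` evaluates to ±m = 0 in F, which is absurd. -/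
lemma lamZero_aux (ha : IsStructureSeq a) (h3 : a 3 = 1) (hN : 7 ≤ N) (hN3 : N % 3 = 1)
    (p1 : ∀ i, 4 ≤ i → i < N → i % 3 = 1 → a i = 1)
    (p2 : ∀ i, 4 ≤ i → i < N → i % 3 = 2 → a i = 0)
    (p0 : ∀ i, 4 ≤ i → i < N → i % 3 = 0 → a i = -1) :
    a N = 1 := by
  have t : (3 : F) = 0 := three_eq_zero_of_charP
  obtain h | ⟨h10, t0, t2, t3, t4⟩ := ha.lamZero_eq_one_or_eq_zero h3 hN hN3 p1 p2 p0
  · exact h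
  have hodd : ¬ Even N := fun hev => by
    have h := ha.sum_three_eq_zero_of_even (n := N - 6)
      ((Nat.even_sub (by omega)).mpr (by simp [hev, show Even 6 by decide])) fun k hk => by
        rcases (by omega : k % 3 = 0 ∨ k % 3 = 1 ∨ k % 3 = 2) with h | h | h
        · rw [p1 _ (by omega) (by omega) (by omega), p2 _ (by omega) (by omega) (by omega),
            p0 _ (by omega) (by omega) (by omega)]; ring
        · rw [p2 _ (by omega) (by omega) (by omega), p0 _ (by omega) (by omega) (by omega),
            p1 _ (by omega) (by omega) (by omega)]; ring
        · rw [p0 _ (by omega) (by omega) (by omega), p1 _ (by omega) (by omega) (by omega),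
            p2 _ (by omega) (by omega) (by omega)]; ring
    rw [p2 _ (by omega) (by omega) (by omega), p0 _ (by omega) (by omega) (by omega),
      show N - 6 + 6 = N by omega, t0] at h
    simp at h
  exfalso
  obtain ⟨r, m, hm3, hNm⟩ := Nat.exists_eq_pow_mul_and_not_dvd (n := N - 1) (by omega) 3
    (by norm_num)
  have hr : 1 ≤ r := by
    rcases Nat.eq_zero_or_pos r with rfl | h
    · exfalso; apply hm3; rw [pow_zero, one_mul] at hNm; omega
    · exact h
  have hm : 2 ≤ m := by
    rcases (by omega : m = 0 ∨ m = 1 ∨ 2 ≤ m) with rfl | rfl | h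
    · omega
    -- Here N = 3^r + 1 would be even.
    · exfalso
      rw [mul_one] at hNm
      have := (show Odd 3 by decide).pow (n := r)
      rw [← hNm] at this
      apply hodd
      have := this.add_one
      rwa [show N - 1 + 1 = N by omega] at this
    · exact h
  have hNm' : N = 3 ^ r * m + 1 := by omega
  obtain ⟨m, rfl⟩ := Nat.exists_eq_add_of_le' hm
  obtain ⟨q', hq'⟩ : 3 ∣ 3 ^ r := dvd_pow_self 3 (by omega)
  have tail := ha.lamZero_tail h3 hr hm hNm' p1 p2 p0 t2 t3 t4
  have hq0 : 0 < 3 ^ r := by positivity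
  -- The former `m` is now `m + 2`, so N - 2 = q(m+1) + (q-1): the difference is m + 1 steps 1 - S^q
  -- applied to sums over windows of length q.
  have hanti := ha.anti (N - 2) (3 ^ r)
  rw [show N - 2 = 3 ^ r * (m + 1) + (3 ^ r - 1) by rw [hNm', mul_add, mul_add]; omega,
    Function.iterate_add_apply, Function.iterate_mul, backDiff_iterate_pow_three,
    show 3 ^ r * (m + 1) + (3 ^ r - 1) + 2 = N by rw [hNm', mul_add, mul_add]; omega, t0] at hanti
  obtain ⟨n, rfl⟩ : ∃ n, q' = n + 1 := ⟨q' - 1, by omega⟩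
  have hNq : a (N + 3 ^ r) = 0 := by
    rw [← (tail n (by omega)).2.1]; congr 1; omega
  have hS (i : ℕ) : backDiff^[3 ^ r - 1] a i =
      ∑ j ∈ Finset.range (n + 1), (a (i + 3 * j) + a (i + 3 * j + 1) + a (i + 3 * j + 2)) := by
    rw [backDiff_iterate_pow_three_sub_one, hq', Finset.sum_range_three_mul]
    simp only [add_assoc]
  rw [iterate_stepDiff (backDiff_iterate_pow_three r) 0] at hanti
  -- Windows inside the regular pattern sum to 0. The window ending at N lacks its final 1 and sums
  -- to -1; the one starting at N + 1 begins 0, 1, 0, continues with full periods, and sums to 1.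
  · have s1 : backDiff^[3 ^ r - 1] a (3 ^ r + 2 + m * 3 ^ r) = -1 := by
      have e : 3 ^ r + 2 + m * 3 ^ r = N + 1 - 3 ^ r := by
        rw [hNm', mul_add, mul_comm m]; omega
      have hle : 3 ^ r + 4 ≤ N + 1 - 3 ^ r + 2 := by rw [← e]; omega
      rw [hS, e, Finset.sum_range_succ, Finset.sum_eq_zero, p2 _ (by omega) (by omega) (by omega),
        p0 _ (by omega) (by omega) (by omega), show N + 1 - 3 ^ r + 3 * n + 2 = N by omega, t0]
      · ring
      · intro j hj
        rw [Finset.mem_range] at hj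
        rw [p2 _ (by omega) (by omega) (by omega), p0 _ (by omega) (by omega) (by omega),
          p1 _ (by omega) (by omega) (by omega)]
        ring
    have s2 : backDiff^[3 ^ r - 1] a (3 ^ r + 2 + (m + 1) * 3 ^ r) = 1 := by
      have e : 3 ^ r + 2 + (m + 1) * 3 ^ r = N + 1 := by rw [hNm']; ring
      rw [hS, e, Finset.sum_range_succ', Finset.sum_eq_zero]
      · obtain ⟨h1, -⟩ := ha.lamZero_next h3 hN hN3 p2 p0
        simp [h1, t2, t3]
      · intro j hj
        rw [Finset.mem_range] at hj
        have v1 := (tail j (by omega)).2.2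
        obtain ⟨v2, v3, -⟩ := tail (j + 1) (by omega)
        rw [show N + 1 + 3 * (j + 1) = N + 4 + 3 * j by ring, v1,
          show N + 4 + 3 * j + 1 = N + 2 + 3 * (j + 1) by ring, v2,
          show N + 4 + 3 * j + 2 = N + 3 + 3 * (j + 1) by ring, v3]
        ring
    rw [s1, s2, hNq] at hanti
    have hm0 : ((m + 2 : ℕ) : F) = 0 := by
      have h1 : (-1 : F) ^ m * (m + 2) = 0 := by linear_combination -hanti
      push_cast
      exact (mul_eq_zero.mp h1).resolve_left (pow_ne_zero _ (by norm_num))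
    exact hm3 ((CharP.cast_eq_zero_iff F 3 _).mp hm0)
  · intro k hk
    have hk' : 3 ^ r * (k + 3) ≤ 3 ^ r * (m + 2) := Nat.mul_le_mul_left _ (by omega)
    have e : k * 3 ^ r = 3 * (k * (n + 1)) := by rw [hq']; ring
    have e' : 3 ^ r * (k + 3) = k * 3 ^ r + 3 * 3 ^ r := by ring
    rw [hS, Finset.sum_eq_zero]
    intro j hj
    rw [Finset.mem_range] at hj
    rw [p2 _ (by omega) (by omega) (by omega), p0 _ (by omega) (by omega) (by omega),
      p1 _ (by omega) (by omega) (by omega)]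
    ring

/-! ### The degenerate parameter λ = -1 -/

section LamNegOne

lemma lamNegOne_start (ha : IsStructureSeq a) (h3 : a 3 = 1) (hN : 9 ≤ N) (hN3 : N % 3 = 0)
    (p1 : ∀ i, 4 ≤ i → i < N → i % 3 = 1 → a i = 1)
    (p2 : ∀ i, 4 ≤ i → i < N → i % 3 = 2 → a i = -1)
    (p0 : ∀ i, 4 ≤ i → i < N → i % 3 = 0 → a i = 0) :
    a N = 0 ∨ (a N = 1 ∧ a (N + 1) = -1 ∧ a (N + 2) = 0) := by
  have t : (3 : F) = 0 := three_eq_zero_of_charP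
  by_cases hx : a N = 0
  · exact Or.inl hx
  right
  have r1 := ha.rec_three h3 (i := N - 2) (j := N - 1) (k := N) (l := N + 1)
    (by omega) (by omega) (by omega) (by omega)
  have r2 := ha.rec_three h3 (i := N - 1) (j := N) (k := N + 1) (l := N + 2)
    (by omega) (by omega) (by omega) (by omega)
  have r3 := ha.rec_three h3 (i := N) (j := N + 1) (k := N + 2) (l := N + 3)
    (by omega) (by omega) (by omega) (by omega)
  have r4 := ha.rec_three h3 (i := N + 1) (j := N + 2) (k := N + 3) (l := N + 4)
    (by omega) (by omega) (by omega) (by omega)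
  have h47 : a 4 = a 7 := by
    rw [p1 4 (by omega) (by omega) (by omega), p1 7 (by omega) (by omega) (by omega)]
  have h5 := ha.rec_four_five h47 (i := N - 3) (by omega)
    (by rw [p0 _ (by omega) (by omega) (by omega), p1 _ (by omega) (by omega) (by omega),
      p2 _ (by omega) (by omega) (by omega)]; ring)
    (by rw [p0 _ (by omega) (by omega) (by omega), show N - 3 + 3 = N by omega]
        exact fun h => hx h.symm)
  rw [show N - 3 + 5 = N + 2 by omega, show N - 3 + 6 = N + 3 by omega,
    show N - 3 + 7 = N + 4 by omega] at h5
  rw [p1 (N - 2) (by omega) (by omega) (by omega), p2 (N - 1) (by omega) (by omega) (by omega)]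
    at r1
  rw [p2 (N - 1) (by omega) (by omega) (by omega)] at r2
  have h1 : a (N + 1) = 1 + a N := by linear_combination r1
  rw [h1] at r2 r3 r4
  have h2 : a (N + 2) * (a N + 1) = a N - 1 := by
    linear_combination -r2 + (a (N + 2) + 1) * t
  have h3' : a (N + 3) = 1 + a (N + 2) := by
    have : a N * (a (N + 3) - (1 + a (N + 2))) = 0 := by
      linear_combination r3 + a N * a (N + 3) * t
    exact sub_eq_zero.mp ((mul_eq_zero.mp this).resolve_left hx)
  have h4 : a (N + 4) = a (N + 2) - 1 := by
    rw [h3'] at h5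
    linear_combination h5 - a (N + 2) * t
  rw [h3', h4] at r4
  have hx1 : a N = 1 := by
    have : a N * (a N - 1) = 0 := by
      -- By `h2`, `a (N + 2)` is (x - 1)/(x + 1) with x = `a N`; the factor (x + 1)^2 clears
      -- denominators.
      linear_combination (a N + 1) ^ 2 * r4 +
        (a (N + 2) * (a N + 1) + a N - 1 + 2 * a N * (a N + 1)) * h2 +
        (a N ^ 3 + 2 * a N ^ 2 + 1) * t
    exact sub_eq_zero.mp ((mul_eq_zero.mp this).resolve_left hx)
  refine ⟨hx1, ?_, ?_⟩
  · rw [h1, hx1]; linear_combination t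
  · rw [hx1] at h2
    linear_combination -h2 + a (N + 2) * t

/-- As for λ = 0, but now `rec_three` is degenerate where the next 0 is due; `rec_pow` with `a (3 ^
r + 2) = -1` supplies that value. -/
lemma lamNegOne_tail (ha : IsStructureSeq a) (h3 : a 3 = 1) {r m : ℕ} (hr : 1 ≤ r) (hm : 2 ≤ m)
    (hNm : N = 3 ^ r * m + 3)
    (p1 : ∀ i, 4 ≤ i → i < N → i % 3 = 1 → a i = 1)
    (p2 : ∀ i, 4 ≤ i → i < N → i % 3 = 2 → a i = -1)
    (p0 : ∀ i, 4 ≤ i → i < N → i % 3 = 0 → a i = 0)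
    (t0 : a N = 1) (t1 : a (N + 1) = -1) (t2 : a (N + 2) = 0) (s : ℕ)
    (hs : 3 * (s + 1) ≤ 3 ^ r) :
    a (N + 3 * s) = 1 ∧ a (N + 1 + 3 * s) = -1 ∧ a (N + 2 + 3 * s) = 0 ∧
      a (N + 3 + 3 * s) = 1 := by
  have t : (3 : F) = 0 := three_eq_zero_of_charP
  obtain ⟨q', hq'⟩ : 3 ∣ 3 ^ r := dvd_pow_self 3 (by omega)
  have hqm : 3 ^ r * 2 ≤ 3 ^ r * m := Nat.mul_le_mul_left _ hm
  have hN3 : N % 3 = 0 := by rw [hNm, hq', mul_assoc]; omega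
  induction s with
  | zero =>
    refine ⟨t0, t1, t2, ?_⟩
    have e := ha.rec_three h3 (i := N) (j := N + 1) (k := N + 2) (l := N + 3)
      (by omega) (by omega) (by omega) (by omega)
    rw [t0, t1, t2] at e
    simpa using e
  | succ s ih =>
    obtain ⟨u0, u1, u2, v0⟩ := ih (by omega)
    have e1 := ha.rec_three h3 (i := N + 1 + 3 * s) (j := N + 2 + 3 * s) (k := N + 3 + 3 * s)
      (l := N + 4 + 3 * s) (by omega) (by omega) (by omega) (by omega)
    rw [u1, u2, v0] at e1
    have v1 : a (N + 4 + 3 * s) = -1 := by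
      linear_combination -e1 + (a (N + 4 + 3 * s) + 1) * t
    have e2 := ha.rec_pow r (i := N + 3 + 3 * s - 3 ^ r) (j := N + 3 + 3 * s)
      (j₁ := N + 4 + 3 * s) (j₂ := N + 5 + 3 * s) (by omega) rfl rfl (by omega) (by omega)
      (by omega)
    rw [p2 (3 ^ r + 2) (by omega) (by omega) (by omega), p0 (N + 3 + 3 * s - 3 ^ r) (by omega)
      (by omega) (by omega), p1 (N + 3 + 3 * s - 3 ^ r + 1) (by omega) (by omega) (by omega),
      p2 (N + 3 + 3 * s - 3 ^ r + 2) (by omega) (by omega) (by omega), v0, v1] at e2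
    have v2 : a (N + 5 + 3 * s) = 0 := by
      linear_combination -e2 + a (N + 5 + 3 * s) * t
    have e3 := ha.rec_three h3 (i := N + 3 + 3 * s) (j := N + 4 + 3 * s) (k := N + 5 + 3 * s)
      (l := N + 6 + 3 * s) (by omega) (by omega) (by omega) (by omega)
    rw [v0, v1, v2] at e3
    have v3 : a (N + 6 + 3 * s) = 1 := by linear_combination e3
    refine ⟨?_, ?_, ?_, ?_⟩
    · rw [← v0]; congr 1; ring
    · rw [← v1]; congr 1; ring
    · rw [← v2]; congr 1; ring
    · rw [← v3]; congr 1; ring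

/-- The same contradiction with N - 3 = q m in place of N - 1 = q m. -/
lemma lamNegOne_aux (ha : IsStructureSeq a) (h3 : a 3 = 1) (hN : 9 ≤ N) (hN3 : N % 3 = 0)
    (p1 : ∀ i, 4 ≤ i → i < N → i % 3 = 1 → a i = 1)
    (p2 : ∀ i, 4 ≤ i → i < N → i % 3 = 2 → a i = -1)
    (p0 : ∀ i, 4 ≤ i → i < N → i % 3 = 0 → a i = 0) :
    a N = 0 := by
  have t : (3 : F) = 0 := three_eq_zero_of_charP
  obtain h | ⟨t0, t1, t2⟩ := ha.lamNegOne_start h3 hN hN3 p1 p2 p0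
  · exact h
  have hodd : ¬ Even N := fun hev => by
    have h := ha.sum_three_eq_zero_of_even (n := N - 6)
      ((Nat.even_sub (by omega)).mpr (by simp [hev, show Even 6 by decide])) fun k hk => by
        rcases (by omega : k % 3 = 0 ∨ k % 3 = 1 ∨ k % 3 = 2) with h | h | h
        · rw [p1 _ (by omega) (by omega) (by omega), p2 _ (by omega) (by omega) (by omega),
            p0 _ (by omega) (by omega) (by omega)]; ring
        · rw [p2 _ (by omega) (by omega) (by omega), p0 _ (by omega) (by omega) (by omega),
            p1 _ (by omega) (by omega) (by omega)]; ring
        · rw [p0 _ (by omega) (by omega) (by omega), p1 _ (by omega) (by omega) (by omega),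
            p2 _ (by omega) (by omega) (by omega)]; ring
    rw [p1 _ (by omega) (by omega) (by omega), p2 _ (by omega) (by omega) (by omega),
      show N - 6 + 6 = N by omega, t0] at h
    simp at h
  exfalso
  obtain ⟨r, m, hm3, hNm⟩ := Nat.exists_eq_pow_mul_and_not_dvd (n := N - 3) (by omega) 3
    (by norm_num)
  have hr : 1 ≤ r := by
    rcases Nat.eq_zero_or_pos r with rfl | h
    · exfalso; apply hm3; rw [pow_zero, one_mul] at hNm; omega
    · exact h
  have hm : 2 ≤ m := by
    rcases (by omega : m = 0 ∨ m = 1 ∨ 2 ≤ m) with rfl | rfl | h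
    · omega
    · exfalso
      rw [mul_one] at hNm
      have := (show Odd 3 by decide).pow (n := r)
      rw [← hNm] at this
      apply hodd
      have := this.add_odd (show Odd 3 by decide)
      rwa [show N - 3 + 3 = N by omega] at this
    · exact h
  have hNm' : N = 3 ^ r * m + 3 := by omega
  have tail := ha.lamNegOne_tail h3 hr hm hNm' p1 p2 p0 t0 t1 t2
  obtain ⟨m, rfl⟩ : ∃ n, m = n + 1 := ⟨m - 1, by omega⟩
  obtain ⟨q', hq'⟩ : 3 ∣ 3 ^ r := dvd_pow_self 3 (by omega)
  have hq0 : 0 < 3 ^ r := by positivity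
  have hanti := ha.anti (N - 2) (3 ^ r)
  rw [show N - 2 = 3 ^ r * (m + 1) + 1 by omega,
    Function.iterate_add_apply, Function.iterate_mul, backDiff_iterate_pow_three,
    show 3 ^ r * (m + 1) + 1 + 2 = N by omega, t0] at hanti
  obtain ⟨n, rfl⟩ : ∃ n, q' = n + 1 := ⟨q' - 1, by omega⟩
  obtain ⟨-, -, w0, w1⟩ := tail n (by omega)
  rw [show N + 3 + 3 * n = N + 3 ^ r by omega] at w1
  -- Now N - 2 = q(m+1) + 1 with the former `m` written `m + 1`, so window sums give way to single
  -- differences at places ≡ 2 mod 3. These equal -1, except the one from N - 1 to N.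
  rw [iterate_stepDiff (backDiff_iterate_pow_three r) (-1), Function.iterate_one, backDiff,
    backDiff] at hanti
  · have e1 : 3 ^ r + 2 + m * 3 ^ r = N - 1 := by rw [hNm', mul_add, mul_comm m]; omega
    have e2 : 3 ^ r + 2 + (m + 1) * 3 ^ r = N + 2 + 3 * n := by
      rw [hNm', add_mul, mul_add, mul_comm m]; omega
    rw [e1, e2, w0, show N - 1 + 1 = N by omega, show N + 2 + 3 * n + 1 = N + 3 ^ r by omega, w1,
      t0, p2 _ (by omega) (by omega) (by omega)] at hanti
    have hm0 : ((m + 1 : ℕ) : F) = 0 := by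
      have h1 : (-1 : F) ^ m * (m + 1) = 0 := by
        linear_combination -hanti
      push_cast
      exact (mul_eq_zero.mp h1).resolve_left (pow_ne_zero _ (by norm_num))
    exact hm3 ((CharP.cast_eq_zero_iff F 3 _).mp hm0)
  · intro k hk
    have hk' : 3 ^ r * (k + 2) ≤ 3 ^ r * (m + 1) := Nat.mul_le_mul_left _ (by omega)
    have e : k * 3 ^ r = 3 * (k * (n + 1)) := by rw [hq']; ring
    have e' : 3 ^ r * (k + 2) = k * 3 ^ r + 2 * 3 ^ r := by ring
    rw [Function.iterate_one, backDiff, p2 _ (by omega) (by omega) (by omega),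
      p0 _ (by omega) (by omega) (by omega)]
    ring

end LamNegOne

/-- `rec_three` carries the pattern through one period. It loses its force only at `3k + 4` for λ =
0 and at `3k + 6` for λ = -1, where the two deviation arguments take over. -/
theorem periodic (ha : IsStructureSeq a) {lam : F} (h3 : a 3 = 1) (h5 : a 5 = lam) (k : ℕ)
    (hk : 1 ≤ k) :
    a (3 * k + 1) = 1 ∧ a (3 * k + 2) = lam ∧ a (3 * k + 3) = -1 - lam := by
  have t : (3 : F) = 0 := three_eq_zero_of_charP
  induction k using Nat.strong_induction_on with
  | _ k ih =>
    obtain rfl | hk2 : k = 1 ∨ 2 ≤ k := by omega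
    · have e1 := ha.anti 1 1
      have e2 := ha.rec_three h3 (i := 3) (j := 4) (k := 5) (l := 6) (by omega) rfl rfl rfl
      simp only [Function.iterate_one, backDiff, Nat.reduceAdd, h3] at e1
      have h4 : a 4 = 1 := by linear_combination e1 + (a 4 - 1) * t
      rw [h3, h4, h5] at e2
      exact ⟨h4, h5, by linear_combination -e2⟩
    obtain ⟨k, rfl⟩ : ∃ n, k = n + 1 := ⟨k - 1, by omega⟩
    obtain ⟨b1, b2, b0⟩ := ih k (by omega) (by omega)
    have q1 : ∀ i, 4 ≤ i → i < 3 * k + 4 → i % 3 = 1 → a i = 1 := fun i h1 h2 h3 => by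
      rw [← (ih (i / 3) (by omega) (by omega)).1]; congr 1; omega
    have q2 : ∀ i, 4 ≤ i → i < 3 * k + 4 → i % 3 = 2 → a i = lam := fun i h1 h2 h3 => by
      rw [← (ih (i / 3) (by omega) (by omega)).2.1]; congr 1; omega
    have q0 : ∀ i, 4 ≤ i → i < 3 * k + 4 → i % 3 = 0 → a i = -1 - lam := fun i h1 h2 h3 => by
      rw [← (ih (i / 3 - 1) (by omega) (by omega)).2.2]; congr 1; omega
    have r1 := ha.rec_three h3 (i := 3 * k + 1) (j := 3 * k + 2) (k := 3 * k + 3) (l := 3 * k + 4)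
      (by omega) (by omega) (by omega) (by omega)
    have r2 := ha.rec_three h3 (i := 3 * k + 2) (j := 3 * k + 3) (k := 3 * k + 4) (l := 3 * k + 5)
      (by omega) (by omega) (by omega) (by omega)
    have r3 := ha.rec_three h3 (i := 3 * k + 3) (j := 3 * k + 4) (k := 3 * k + 5) (l := 3 * k + 6)
      (by omega) (by omega) (by omega) (by omega)
    rw [b1, b2, b0] at r1
    rw [b2, b0] at r2
    rw [b0] at r3
    have c1 : a (3 * k + 4) = 1 := by
      by_cases hl : lam = 0
      · subst hl
        exact ha.lamZero_aux h3 (by omega) (by omega) q1 q2 fun i h1 h2 h3 => by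
          rw [q0 i h1 h2 h3]; ring
      · have : lam * (a (3 * k + 4) - 1) = 0 := by linear_combination -r1
        exact sub_eq_zero.mp ((mul_eq_zero.mp this).resolve_left hl)
    rw [c1] at r2
    have c2 : a (3 * k + 5) = lam := by
      linear_combination -r2 + (a (3 * k + 5) - lam) * t
    rw [c1, c2] at r3
    have c0 : a (3 * k + 6) = -1 - lam := by
      by_cases hl : lam = -1
      · have h1 : ∀ i, 4 ≤ i → i < 3 * k + 6 → i % 3 = 1 → a i = 1 := fun i h1 h2 h3 => by
          obtain rfl | h := eq_or_ne i (3 * k + 4)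
          · exact c1
          · exact q1 i h1 (by omega) h3
        have h2 : ∀ i, 4 ≤ i → i < 3 * k + 6 → i % 3 = 2 → a i = -1 := fun i h1 h2 h3 => by
          rw [← hl]
          obtain rfl | h := eq_or_ne i (3 * k + 5)
          · exact c2
          · exact q2 i h1 (by omega) h3
        rw [ha.lamNegOne_aux h3 (by omega) (by omega) h1 h2 fun i h1 h2 h3 => by
          rw [q0 i h1 (by omega) h3, hl]; ring, hl]
        ring
      · have : (lam + 1) * (a (3 * k + 6) - (-1 - lam)) = 0 := by linear_combination r3
        exact sub_eq_zero.mp ((mul_eq_zero.mp this).resolve_left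
          fun h => hl (eq_neg_of_add_eq_zero_left h))
    exact ⟨c1, c2, c0⟩

end IsStructureSeq

/-! ### Graded bases, lower central series and maximal class -/

/-- A sequence `b` with `b 0 = 0` whose remaining terms form a basis of the Lie algebra `L`,
compatible with the grading by the index. -/
structure IsGradedBasis (F : Type*) {L : Type*} [Field F] [LieRing L] [LieAlgebra F L]
    (b : ℕ → L) : Prop where
  zero : b 0 = 0
  linearIndependent : LinearIndependent F fun i => b (i + 1)
  span_eq_top : Submodule.span F (Set.range fun i => b (i + 1)) = ⊤
  lie : ∀ i j : ℕ, ∃ c : F, ⁅b i, b j⁆ = c • b (i + j)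

/-- The span of the terms of index at least `n`. -/
def tailSpan (F : Type*) {L : Type*} [Field F] [LieRing L] [LieAlgebra F L]
    (b : ℕ → L) (n : ℕ) : Submodule F L :=
  Submodule.span F (b '' Set.Ici n)

section TailSpan

variable {F L : Type*} [Field F] [LieRing L] [LieAlgebra F L] {b : ℕ → L}

lemma mem_tailSpan {n i : ℕ} (h : n ≤ i) : b i ∈ tailSpan F b n :=
  Submodule.subset_span ⟨i, h, rfl⟩

lemma lie_mem_of_mem_tailSpan {P : Submodule F L} {m n : ℕ}
    (h : ∀ i j, m ≤ i → n ≤ j → ⁅b i, b j⁆ ∈ P) {x y : L} (hx : x ∈ tailSpan F b m)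
    (hy : y ∈ tailSpan F b n) : ⁅x, y⁆ ∈ P := by
  induction hx using Submodule.span_induction with
  | zero => simp
  | add x x' _ _ hx hx' => rw [add_lie]; exact add_mem hx hx'
  | smul c x _ hx => rw [smul_lie]; exact P.smul_mem c hx
  | mem x hx =>
    obtain ⟨i, hi, rfl⟩ := hx
    induction hy using Submodule.span_induction with
    | zero => simp
    | add x x' _ _ hx hx' => rw [lie_add]; exact add_mem hx hx'
    | smul c x _ hx => rw [lie_smul]; exact P.smul_mem c hx
    | mem y hy =>
      obtain ⟨j, hj, rfl⟩ := hy
      exact h i j hi hj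

end TailSpan

namespace IsGradedBasis

variable {F L : Type*} [Field F] [LieRing L] [LieAlgebra F L] {b : ℕ → L}

lemma ne_zero (hb : IsGradedBasis F b) {i : ℕ} (hi : 1 ≤ i) : b i ≠ 0 := by
  obtain ⟨i, rfl⟩ := Nat.exists_eq_add_of_le' hi
  exact hb.linearIndependent.ne_zero i

/-- The basis underlying a graded basis. -/
noncomputable def basis (hb : IsGradedBasis F b) : Module.Basis ℕ F L :=
  Module.Basis.mk hb.linearIndependent hb.span_eq_top.ge

lemma basis_apply (hb : IsGradedBasis F b) (i : ℕ) : hb.basis i = b (i + 1) := by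
  simp [basis]

lemma tailSpan_one (hb : IsGradedBasis F b) : tailSpan F b 1 = ⊤ := by
  rw [← top_le_iff, ← hb.span_eq_top]
  refine Submodule.span_mono ?_
  rintro _ ⟨i, rfl⟩
  exact ⟨i + 1, by simp, rfl⟩

lemma finrank_quotient_tailSpan (hb : IsGradedBasis F b) (n : ℕ) :
    Module.finrank F (L ⧸ tailSpan F b (n + 1)) = n := by
  let f : L →ₗ[F] (Fin n → F) := LinearMap.pi fun i => hb.basis.coord i
  have hker : LinearMap.ker f = tailSpan F b (n + 1) := by
    have e : b '' Set.Ici (n + 1) = hb.basis '' Set.Ici n := by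
      ext x
      simp only [Set.mem_image, Set.mem_Ici, basis_apply]
      constructor
      · rintro ⟨i, hi, rfl⟩
        exact ⟨i - 1, by omega, by congr 1; omega⟩
      · rintro ⟨i, hi, rfl⟩
        exact ⟨i + 1, by omega, rfl⟩
    ext x
    rw [tailSpan, e, hb.basis.mem_span_image, LinearMap.mem_ker]
    constructor
    · intro h i hi
      by_contra hlt
      rw [Set.mem_Ici, not_le] at hlt
      have := congrFun h ⟨i, hlt⟩
      simp only [f, LinearMap.pi_apply, Module.Basis.coord_apply, Pi.zero_apply] at this
      exact (Finsupp.mem_support_iff.mp hi) this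
    · intro h
      ext i
      by_contra hne
      have := h (Finsupp.mem_support_iff.mpr hne)
      have := i.2
      simp only [Set.mem_Ici] at *
      omega
  have hsurj : Function.Surjective f := by
    intro v
    refine ⟨∑ i : Fin n, v i • hb.basis i, ?_⟩
    ext j
    simp [f, Finsupp.single_apply, Fin.val_inj]
  rw [← hker, (f.quotKerEquivOfSurjective hsurj).finrank_eq]
  simp

lemma lie_mem_tailSpan (hb : IsGradedBasis F b) {n i j : ℕ} (h : n ≤ i + j) :
    ⁅b i, b j⁆ ∈ tailSpan F b n := by
  obtain ⟨c, hc⟩ := hb.lie i j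
  rw [hc]
  exact Submodule.smul_mem _ _ (mem_tailSpan h)

lemma lie_mem_tailSpan_three (hb : IsGradedBasis F b) {i j : ℕ} (hi : 1 ≤ i) (hj : 1 ≤ j) :
    ⁅b i, b j⁆ ∈ tailSpan F b 3 := by
  by_cases h : 3 ≤ i + j
  · exact hb.lie_mem_tailSpan h
  · obtain rfl : i = 1 := by omega
    obtain rfl : j = 1 := by omega
    simp

lemma lowerCentralSeries_succ_le {P : Submodule F L} {k : ℕ}
    (h : ∀ x : L, ∀ y ∈ LieModule.lowerCentralSeries F L L k, ⁅x, y⁆ ∈ P) :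
    (LieModule.lowerCentralSeries F L L (k + 1)).toSubmodule ≤ P := by
  rw [LieModule.lowerCentralSeries_succ, LieSubmodule.lieIdeal_oper_eq_linear_span',
    Submodule.span_le]
  rintro _ ⟨x, -, y, hy, rfl⟩
  exact h x y hy

/-- Since `[b_1, b_1] = 0`, the derived algebra already starts in weight 3; each further bracket
raises the weight by at least one. -/
lemma lowerCentralSeries_le_tailSpan (hb : IsGradedBasis F b) (k : ℕ) :
    (LieModule.lowerCentralSeries F L L (k + 1)).toSubmodule ≤ tailSpan F b (k + 3) := by
  induction k with
  | zero =>
    refine lowerCentralSeries_succ_le fun x y _ => ?_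
    have hx : x ∈ tailSpan F b 1 := hb.tailSpan_one ▸ Submodule.mem_top
    have hy : y ∈ tailSpan F b 1 := hb.tailSpan_one ▸ Submodule.mem_top
    exact lie_mem_of_mem_tailSpan (fun i j => hb.lie_mem_tailSpan_three) hx hy
  | succ k ih =>
    refine lowerCentralSeries_succ_le fun x y hy => ?_
    have hx : x ∈ tailSpan F b 1 := hb.tailSpan_one ▸ Submodule.mem_top
    exact lie_mem_of_mem_tailSpan (fun i j hi hj => hb.lie_mem_tailSpan (by omega)) hx (ih hy)

/-- Weight n + 1 of the Lie power L^n can only come from `b_n` and `b_1`. Were their bracket zero,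
L^n would lie in weights ≥ n + 2, a subspace of codimension n + 1, against codimension n. -/
lemma lie_one_ne_zero (hb : IsGradedBasis F b) (hL : IsMaximalClass F L) {n : ℕ} (hn : 2 ≤ n) :
    ⁅b n, b 1⁆ ≠ 0 := by
  intro h0
  obtain ⟨n, rfl⟩ := Nat.exists_eq_add_of_le' hn
  have hle : (LieModule.lowerCentralSeries F L L (n + 1)).toSubmodule ≤ tailSpan F b (n + 4) := by
    refine lowerCentralSeries_succ_le fun x y hy => ?_
    have hx : x ∈ tailSpan F b 1 := hb.tailSpan_one ▸ Submodule.mem_top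
    have h1 : ⁅b 1, b (n + 2)⁆ = 0 := by rw [← lie_skew, h0, neg_zero]
    rcases n with _ | n
    · have hy' : y ∈ tailSpan F b 1 := hb.tailSpan_one ▸ Submodule.mem_top
      refine lie_mem_of_mem_tailSpan (fun i j hi hj => ?_) hx hy'
      by_cases h : 4 ≤ i + j
      · exact hb.lie_mem_tailSpan h
      · have : (i = 1 ∧ j = 1) ∨ (i = 1 ∧ j = 2) ∨ (i = 2 ∧ j = 1) := by omega
        rcases this with ⟨rfl, rfl⟩ | ⟨rfl, rfl⟩ | ⟨rfl, rfl⟩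
        · simp
        · rw [h1]; exact zero_mem _
        · rw [h0]; exact zero_mem _
    · refine lie_mem_of_mem_tailSpan (fun i j hi hj => ?_) hx
        (hb.lowerCentralSeries_le_tailSpan n hy)
      by_cases h : n + 1 + 4 ≤ i + j
      · exact hb.lie_mem_tailSpan h
      · obtain rfl : i = 1 := by omega
        obtain rfl : j = n + 1 + 2 := by omega
        rw [h1]; exact zero_mem _
  have hfin : Module.finrank F
      (L ⧸ (LieModule.lowerCentralSeries F L L (n + 1)).toSubmodule) = n + 2 :=
    hL (n + 1) (by omega)
  -- `finrank` is 0 in infinite dimension, so its positivity gives the finiteness needed to compare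
  -- ranks.
  have hfd : Module.Finite F (L ⧸ (LieModule.lowerCentralSeries F L L (n + 1)).toSubmodule) :=
    Module.finite_of_finrank_pos (by omega)
  have h := LinearMap.finrank_le_finrank_of_surjective (f := Submodule.factor hle)
    (Submodule.factor_surjective hle)
  rw [hfin, hb.finrank_quotient_tailSpan] at h
  omega

lemma isMaximalClass (hb : IsGradedBasis F b) (h : ∀ n, 2 ≤ n → ⁅b n, b 1⁆ = b (n + 1)) :
    IsMaximalClass F L := by
  have hmem (k : ℕ) : b (k + 3) ∈ LieModule.lowerCentralSeries F L L (k + 1) := by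
    induction k with
    | zero =>
      rw [← h 2 le_rfl, LieModule.lowerCentralSeries_succ, ← lie_skew]
      exact neg_mem (LieSubmodule.lie_mem_lie (LieSubmodule.mem_top _) (LieSubmodule.mem_top _))
    | succ k ih =>
      rw [show k + 1 + 3 = k + 3 + 1 by ring, ← h (k + 3) (by omega),
        LieModule.lowerCentralSeries_succ, ← lie_skew]
      exact neg_mem (LieSubmodule.lie_mem_lie (LieSubmodule.mem_top _) ih)
  intro k hk
  obtain ⟨k, rfl⟩ := Nat.exists_eq_add_of_le' hk
  have heq : (LieModule.lowerCentralSeries F L L (k + 1)).toSubmodule = tailSpan F b (k + 3) := by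
    refine le_antisymm (hb.lowerCentralSeries_le_tailSpan k) (Submodule.span_le.mpr ?_)
    rintro _ ⟨i, hi, rfl⟩
    obtain ⟨j, rfl⟩ := Nat.exists_eq_add_of_le' (Set.mem_Ici.mp hi)
    have := hmem (j + k)
    rw [← add_assoc]
    exact LieModule.antitone_lowerCentralSeries F L L (by omega) this
  change Module.finrank F (L ⧸ (LieModule.lowerCentralSeries F L L (k + 1)).toSubmodule) = _
  rw [heq, hb.finrank_quotient_tailSpan]

/-- The grading by the spans of the terms of a graded basis. -/
lemma nonempty_gradedLieAlgebra (hb : IsGradedBasis F b) :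
    Nonempty (GradedLieAlgebra fun i => Submodule.span F {b i}) := by
  have hint : DirectSum.IsInternal fun i => Submodule.span F {b i} := by
    rw [DirectSum.isInternal_submodule_iff_iSupIndep_and_iSup_eq_top]
    constructor
    -- The zero component in weight 0 is discarded before independence of the vectors is used.
    · rw [← iSupIndep_ne_bot]
      have hi (i : {i : ℕ // Submodule.span F {b i} ≠ ⊥}) : i.1 ≠ 0 := fun h =>
        i.2 (by rw [h, hb.zero, Submodule.span_zero_singleton])
      have h := hb.linearIndependent.comp
        (fun i : {i : ℕ // Submodule.span F {b i} ≠ ⊥} => i.1 - 1) fun i j h => by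
          have := hi i
          have := hi j
          simp only at h
          ext
          omega
      convert h.iSupIndep_span_singleton using 3 with i
      have := hi i
      simp only [Function.comp, show i.1 - 1 + 1 = i.1 by omega]
    · rw [← Submodule.span_iUnion, ← top_le_iff, ← hb.span_eq_top]
      refine Submodule.span_mono ?_
      rintro _ ⟨i, rfl⟩
      exact Set.mem_iUnion.mpr ⟨i + 1, rfl⟩
  let _ := hint.chooseDecomposition
  exact ⟨{ bracket_mem := by
            intro i j x y hx hy
            obtain ⟨c, rfl⟩ := Submodule.mem_span_singleton.mp hx
            obtain ⟨d, rfl⟩ := Submodule.mem_span_singleton.mp hy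
            obtain ⟨f, hf⟩ := hb.lie i j
            rw [smul_lie, lie_smul, hf]
            exact Submodule.smul_mem _ _ (Submodule.smul_mem _ _
              (Submodule.smul_mem _ _ (Submodule.mem_span_singleton_self _))) }⟩

end IsGradedBasis

/-! ### Algebras of type 2 have the `e_i` as a graded basis -/

namespace IsTypeTwo

variable {F L : Type*} [Field F] [LieRing L] [LieAlgebra F L] {ℒ : ℕ → Submodule F L}

lemma eq_span_singleton (h : IsTypeTwo ℒ) {b : ℕ → L} (h0 : b 0 = 0) (hmem : ∀ i, b i ∈ ℒ i)
    (hne : ∀ i, 1 ≤ i → b i ≠ 0) (i : ℕ) : ℒ i = Submodule.span F {b i} := by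
  rcases Nat.eq_zero_or_pos i with rfl | hi
  · rw [h0, Submodule.span_zero_singleton, h.zero_eq_bot]
  · have hf := h.finrank_eq_one i hi
    have : Module.Finite F (ℒ i) := Module.finite_of_finrank_pos (by omega)
    refine (Submodule.eq_of_le_of_finrank_eq ?_ ?_).symm
    · rw [Submodule.span_singleton_le_iff_mem]
      exact hmem i
    · rw [hf, finrank_span_singleton (hne i hi)]

lemma isGradedBasis (h : IsTypeTwo ℒ) {b : ℕ → L} (h0 : b 0 = 0) (hmem : ∀ i, b i ∈ ℒ i)
    (hne : ∀ i, 1 ≤ i → b i ≠ 0) : IsGradedBasis F b := by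
  obtain ⟨hg⟩ := h.graded
  have hint := DirectSum.Decomposition.isInternal ℒ
  rw [DirectSum.isInternal_submodule_iff_iSupIndep_and_iSup_eq_top] at hint
  refine ⟨h0, ?_, ?_, fun i j => ?_⟩
  · exact (hint.1.comp (add_left_injective 1)).linearIndependent _ (fun i => hmem (i + 1))
      fun i => hne (i + 1) (by omega)
  · rw [← top_le_iff, ← hint.2, iSup_le_iff]
    intro i
    rw [h.eq_span_singleton h0 hmem hne, Submodule.span_singleton_le_iff_mem]
    rcases i with _ | i
    · rw [h0]; exact zero_mem _
    · exact Submodule.subset_span ⟨i, rfl⟩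
  · have := hg.bracket_mem (hmem i) (hmem j)
    rw [h.eq_span_singleton h0 hmem hne, Submodule.mem_span_singleton] at this
    obtain ⟨c, hc⟩ := this
    exact ⟨c, hc.symm⟩

/-- `x` and `y` extend to a choice of a nonzero element in every positive weight. Such a choice is a
graded basis, whereas the `e_i` are not yet known to be nonzero. -/
lemma lie_ne_zero (h : IsTypeTwo ℒ) {n : ℕ} (hn : 2 ≤ n) {x y : L} (hx : x ∈ ℒ n) (hy : y ∈ ℒ 1)
    (hx0 : x ≠ 0) (hy0 : y ≠ 0) : ⁅x, y⁆ ≠ 0 := by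
  have hex (i : ℕ) : ∃ z ∈ ℒ i, (i = 0 → z = 0) ∧ (1 ≤ i → z ≠ 0) ∧ (i = n → z = x) ∧
      (i = 1 → z = y) := by
    by_cases hin : i = n
    · exact ⟨x, hin ▸ hx, by omega, fun _ => hx0, fun _ => rfl, by omega⟩
    by_cases hi1 : i = 1
    · exact ⟨y, hi1 ▸ hy, by omega, fun _ => hy0, by omega, fun _ => rfl⟩
    rcases Nat.eq_zero_or_pos i with rfl | hi
    · exact ⟨0, zero_mem _, fun _ => rfl, by omega, by omega, by omega⟩
    · have : ℒ i ≠ ⊥ := fun hbot => by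
        have := h.finrank_eq_one i hi
        rw [hbot, finrank_bot] at this
        omega
      obtain ⟨z, hz, hz0⟩ := Submodule.exists_mem_ne_zero_of_ne_bot this
      exact ⟨z, hz, by omega, fun _ => hz0, by omega, by omega⟩
  choose b hmem h0 hne hbn hb1 using hex
  have := (h.isGradedBasis (h0 0 rfl) hmem hne).lie_one_ne_zero h.maximalClass hn
  rwa [hbn n rfl, hb1 1 rfl] at this

lemma weightSeq_mem (h : IsTypeTwo ℒ) {e₁ e₂ : L} (h₁ : e₁ ∈ ℒ 1) (h₂ : e₂ ∈ ℒ 2) (i : ℕ) :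
    weightSeq e₁ e₂ i ∈ ℒ i := by
  obtain ⟨hg⟩ := h.graded
  rcases i with _ | _ | i
  · exact zero_mem _
  · exact h₁
  · induction i with
    | zero => exact h₂
    | succ i ih => exact hg.bracket_mem ih h₁

lemma weightSeq_ne_zero (h : IsTypeTwo ℒ) {e₁ e₂ : L} (h₁ : e₁ ∈ ℒ 1) (h₂ : e₂ ∈ ℒ 2)
    (n₁ : e₁ ≠ 0) (n₂ : e₂ ≠ 0) (i : ℕ) (hi : 1 ≤ i) : weightSeq e₁ e₂ i ≠ 0 := by
  rcases i with _ | _ | i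
  · omega
  · exact n₁
  · induction i with
    | zero => exact n₂
    | succ i ih =>
      exact h.lie_ne_zero (by omega) (h.weightSeq_mem h₁ h₂ (i + 2)) h₁ (ih (by omega)) n₁

lemma isGradedBasis_weightSeq (h : IsTypeTwo ℒ) {e₁ e₂ : L} (h₁ : e₁ ∈ ℒ 1) (h₂ : e₂ ∈ ℒ 2)
    (n₁ : e₁ ≠ 0) (n₂ : e₂ ≠ 0) : IsGradedBasis F (weightSeq e₁ e₂) :=
  h.isGradedBasis rfl (h.weightSeq_mem h₁ h₂) (h.weightSeq_ne_zero h₁ h₂ n₁ n₂)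

end IsTypeTwo

lemma weightSeq_lie_one {L : Type*} [LieRing L] (e₁ e₂ : L) (i : ℕ) (hi : 2 ≤ i) :
    ⁅weightSeq e₁ e₂ i, weightSeq e₁ e₂ 1⁆ = weightSeq e₁ e₂ (i + 1) := by
  obtain ⟨i, rfl⟩ := Nat.exists_eq_add_of_le' hi
  rfl

/-! ### From a graded basis to the multiplication table -/

namespace IsGradedBasis

variable {F L : Type*} [Field F] [LieRing L] [LieAlgebra F L] {e : ℕ → L}

/-- All brackets are determined by those with `e 1` and `e 2`. -/
lemma lie_eq_backDiff (h1 : ∀ i, 2 ≤ i → ⁅e i, e 1⁆ = e (i + 1)) {a : ℕ → F}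
    (ha : ∀ i, ⁅e i, e 2⁆ = a i • e (i + 2)) (j i : ℕ) :
    ⁅e (i + 2), e (j + 2)⁆ = backDiff^[j] a (i + 2) • e (i + j + 4) := by
  induction j generalizing i with
  | zero => exact ha (i + 2)
  | succ j ih =>
    have h2 := ih (i + 1)
    rw [add_right_comm i 1 2] at h2
    -- Expanding `[e_{i+2}, [e_{j+2}, e_1]]` by Jacobi turns one more bracketing with `e_1` into one
    -- more difference.
    rw [Function.iterate_succ_apply', backDiff, show j + 1 + 2 = j + 2 + 1 by ring,
      ← h1 (j + 2) (by omega), leibniz_lie, ih i, smul_lie, h1 (i + j + 4) (by omega),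
      h1 (i + 2) (by omega), ← lie_skew, h2, sub_smul,
      show i + 1 + j + 4 = i + j + 4 + 1 by ring,
      show i + (j + 1) + 4 = i + j + 4 + 1 by ring, sub_eq_add_neg]

lemma isStructureSeq (hb : IsGradedBasis F e) (h1 : ∀ i, 2 ≤ i → ⁅e i, e 1⁆ = e (i + 1))
    {a : ℕ → F} (ha : ∀ i, ⁅e i, e 2⁆ = a i • e (i + 2)) : IsStructureSeq a := by
  have key := lie_eq_backDiff h1 ha
  refine ⟨fun i j => ?_, fun m n i => ?_⟩
  · have h := lie_skew (e (i + 2)) (e (j + 2))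
    rw [key, key, add_comm j i, ← neg_smul] at h
    have := smul_left_injective F (hb.ne_zero (i := i + j + 4) (by omega)) h
    linear_combination -this
  · have h := leibniz_lie (e (i + 2)) (e (m + 2)) (e (n + 2))
    have k1 := key (m + n + 2) i
    have k2 := key n (i + m + 2)
    have k3 := key m (i + n + 2)
    rw [show m + n + 2 + 2 = m + n + 4 by ring,
      show i + (m + n + 2) + 4 = i + m + n + 6 by ring] at k1
    rw [show i + m + 2 + 2 = i + m + 4 by ring, show i + m + 2 + n + 4 = i + m + n + 6 by ring]
      at k2
    rw [show i + n + 2 + 2 = i + n + 4 by ring, show i + n + 2 + m + 4 = i + m + n + 6 by ring]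
      at k3
    rw [key, key, key, lie_smul, lie_smul, smul_lie, ← lie_skew (e (m + 2)), k1, k2, k3,
      ← neg_smul, smul_smul, smul_smul, smul_smul, ← add_smul] at h
    have := smul_left_injective F (hb.ne_zero (i := i + m + n + 6) (by omega)) h
    linear_combination this

lemma hasTable [CharP F 3] (hb : IsGradedBasis F e) (h1 : ∀ i, 2 ≤ i → ⁅e i, e 1⁆ = e (i + 1))
    {lam : F} (h3 : ⁅e 3, e 2⁆ = e 5) (h5 : ⁅e 5, e 2⁆ = lam • e 7) : HasTable lam e := by
  have t : (3 : F) = 0 := three_eq_zero_of_charP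
  choose a ha using fun i => hb.lie i 2
  have hs := hb.isStructureSeq h1 ha
  have ha3 : a 3 = 1 := by
    have h := ha 3
    rw [h3] at h
    refine smul_left_injective F (hb.ne_zero (i := 5) (by omega)) ?_
    simpa using h.symm
  have ha5 : a 5 = lam :=
    smul_left_injective F (hb.ne_zero (i := 7) (by omega)) ((ha 5).symm.trans h5)
  have per := hs.periodic ha3 ha5
  have mods (k : ℕ) (hk : 4 ≤ k) : ∃ n, 1 ≤ n ∧ (k = 3 * n + 1 ∨ k = 3 * n + 2 ∨ k = 3 * n + 3) :=
    ⟨(k - 1) / 3, by omega, by omega⟩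
  -- In characteristic 3 the cyclic differences of 1, λ, -1-λ all equal 1 - λ; hence second
  -- differences vanish, and with them the brackets among the `e_i`, `i ≥ 4`.
  have hdiff (k : ℕ) (hk : 4 ≤ k) : a k - a (k + 1) = 1 - lam := by
    obtain ⟨n, hn, rfl | rfl | rfl⟩ := mods k hk
    · rw [(per n hn).1, (per n hn).2.1]
    · rw [(per n hn).2.1, (per n hn).2.2]; linear_combination lam * t
    · rw [(per n hn).2.2, show 3 * n + 3 + 1 = 3 * (n + 1) + 1 by ring,
        (per (n + 1) (by omega)).1]
      linear_combination -t
  have hsum (k : ℕ) (hk : 4 ≤ k) : backDiff^[2] a k = 0 := by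
    change a k - a (k + 1) - (a (k + 1) - a (k + 1 + 1)) = 0
    rw [hdiff k hk, hdiff (k + 1) (by omega), sub_self]
  refine ⟨h1, h3, fun k hk => ?_, fun k hk => ?_, fun k hk => ?_, fun k hk => ?_,
    fun k m hk hm => ?_⟩
  · rw [ha, (per k hk).1, one_smul]
  · rw [ha, (per k hk).2.1]
  · rw [ha, (per k hk).2.2]
  · obtain ⟨i, rfl⟩ := Nat.exists_eq_add_of_le' (show 2 ≤ k by omega)
    rw [show 3 = 1 + 2 by rfl, lie_eq_backDiff h1 ha, Function.iterate_one, backDiff, hdiff _ hk]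
  · obtain ⟨i, rfl⟩ := Nat.exists_eq_add_of_le' (show 2 ≤ k by omega)
    obtain ⟨j, rfl⟩ := Nat.exists_eq_add_of_le' hm
    rw [show j + 4 = j + 2 + 2 by rfl, lie_eq_backDiff h1 ha, Function.iterate_add_apply,
      backDiff_iterate_of_eq_zero fun n _ => hsum _ (by omega), hsum _ (by omega), mul_zero,
      zero_smul]

end IsGradedBasis

/-! ### Consequences of the table: type 2, solubility, uniqueness -/

/-- The structure constants `[e_i, e_j] = c e_{i+j}` in the table for `i > j`. -/
def tableCoeffOfLt {F : Type*} [Field F] (lam : F) (i j : ℕ) : F :=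
  if j = 1 then 1
  else if j = 2 then
    if i = 3 then 1 else if i % 3 = 1 then 1 else if i % 3 = 2 then lam else -1 - lam
  else if j = 3 then 1 - lam
  else 0

/-- The structure constants of the algebra with parameter `lam`. -/
def tableCoeff {F : Type*} [Field F] (lam : F) (i j : ℕ) : F :=
  if i = j then 0 else if j < i then tableCoeffOfLt lam i j else -tableCoeffOfLt lam j i

namespace HasTable

variable {F L : Type*} [Field F] [LieRing L] [LieAlgebra F L] {lam : F} {e : ℕ → L}

lemma lie_of_lt (h : HasTable lam e) {i j : ℕ} (hj : 1 ≤ j) (hij : j < i) :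
    ⁅e i, e j⁆ = tableCoeffOfLt lam i j • e (i + j) := by
  unfold tableCoeffOfLt
  split_ifs with h1 h2 h3 h4 h5 h6
  · subst h1; rw [h.lie_one i (by omega), one_smul]
  · subst h2 h3; rw [h.lie_three_two, one_smul]
  · subst h2
    have := h.lie_two_of_one_mod (i / 3) (by omega)
    rw [show 3 * (i / 3) + 1 = i by omega, show 3 * (i / 3) + 3 = i + 2 by omega] at this
    rw [this, one_smul]
  · subst h2
    have := h.lie_two_of_two_mod (i / 3) (by omega)
    rwa [show 3 * (i / 3) + 2 = i by omega, show 3 * (i / 3) + 4 = i + 2 by omega] at this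
  · subst h2
    have := h.lie_two_of_zero_mod (i / 3 - 1) (by omega)
    rwa [show 3 * (i / 3 - 1) + 3 = i by omega, show 3 * (i / 3 - 1) + 5 = i + 2 by omega] at this
  · subst h6; exact h.lie_three i (by omega)
  · rw [h.lie_eq_zero i j (by omega) (by omega), zero_smul]

lemma lie_eq (h : HasTable lam e) {i j : ℕ} (hi : 1 ≤ i) (hj : 1 ≤ j) :
    ⁅e i, e j⁆ = tableCoeff lam i j • e (i + j) := by
  unfold tableCoeff
  split_ifs with h1 h2
  · subst h1; simp
  · exact h.lie_of_lt hj h2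
  · rw [← lie_skew, h.lie_of_lt hi (by omega), neg_smul, add_comm]

lemma lie_exists (h : HasTable lam e) (h0 : e 0 = 0) (i j : ℕ) :
    ∃ c : F, ⁅e i, e j⁆ = c • e (i + j) := by
  rcases Nat.eq_zero_or_pos i with rfl | hi
  · exact ⟨0, by simp [h0]⟩
  rcases Nat.eq_zero_or_pos j with rfl | hj
  · exact ⟨0, by simp [h0]⟩
  exact ⟨_, h.lie_eq hi hj⟩

lemma isTypeTwo (h : HasTable lam e) (hb : IsGradedBasis F e) :
    IsTypeTwo fun i => Submodule.span F {e i} where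
  graded := hb.nonempty_gradedLieAlgebra
  zero_eq_bot := by rw [hb.zero, Submodule.span_zero_singleton]
  finrank_eq_one i hi := finrank_span_singleton (hb.ne_zero hi)
  generated := by
    have hmem (i : ℕ) (hi : 1 ≤ i) : e i ∈ LieSubalgebra.lieSpan F L
        ((Submodule.span F {e 1} : Set L) ∪ (Submodule.span F {e 2} : Set L)) := by
      have m1 : e 1 ∈ LieSubalgebra.lieSpan F L
          ((Submodule.span F {e 1} : Set L) ∪ (Submodule.span F {e 2} : Set L)) :=
        LieSubalgebra.subset_lieSpan (Or.inl (Submodule.mem_span_singleton_self _))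
      rcases i with _ | _ | i
      · omega
      · exact m1
      · induction i with
        | zero =>
          exact LieSubalgebra.subset_lieSpan (Or.inr (Submodule.mem_span_singleton_self _))
        | succ i ih =>
          rw [← h.lie_one (i + 2) (by omega)]
          exact LieSubalgebra.lie_mem _ (ih (by omega)) m1
    rw [← LieSubalgebra.toSubmodule_inj, LieSubalgebra.top_toSubmodule, ← top_le_iff,
      ← hb.span_eq_top, Submodule.span_le]
    rintro _ ⟨i, rfl⟩
    exact hmem (i + 1) (by omega)
  maximalClass := hb.isMaximalClass h.lie_one

/-- The derived series falls into weights ≥ 3, then ≥ 4, where all brackets vanish. -/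
lemma isSolvable (h : HasTable lam e) (hb : IsGradedBasis F e) : LieAlgebra.IsSolvable L := by
  have hle {P Q : Submodule F L} {I : LieIdeal F L} (hI : I.toSubmodule ≤ P)
      (hPQ : ∀ x ∈ P, ∀ y ∈ P, ⁅x, y⁆ ∈ Q) : (⁅I, I⁆ : LieIdeal F L).toSubmodule ≤ Q := by
    rw [LieSubmodule.lieIdeal_oper_eq_linear_span', Submodule.span_le]
    rintro _ ⟨x, hx, y, hy, rfl⟩
    exact hPQ x (hI hx) y (hI hy)
  have h1 : (LieAlgebra.derivedSeries F L 1).toSubmodule ≤ tailSpan F e 3 := by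
    rw [LieAlgebra.derivedSeries_def, LieAlgebra.derivedSeriesOfIdeal_succ]
    refine hle (P := tailSpan F e 1) (by rw [hb.tailSpan_one]; exact le_top) fun x hx y hy => ?_
    exact lie_mem_of_mem_tailSpan (fun i j => hb.lie_mem_tailSpan_three) hx hy
  have h2 : (LieAlgebra.derivedSeries F L 2).toSubmodule ≤ tailSpan F e 4 := by
    rw [LieAlgebra.derivedSeries_def, LieAlgebra.derivedSeriesOfIdeal_succ]
    refine hle h1 fun x hx y hy => ?_
    exact lie_mem_of_mem_tailSpan (fun i j hi hj => hb.lie_mem_tailSpan (by omega)) hx hy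
  have h3 : (LieAlgebra.derivedSeries F L 3).toSubmodule ≤ ⊥ := by
    rw [LieAlgebra.derivedSeries_def, LieAlgebra.derivedSeriesOfIdeal_succ]
    refine hle h2 fun x hx y hy => ?_
    exact lie_mem_of_mem_tailSpan (fun i j hi hj => by
      rw [h.lie_eq_zero i j hi hj]; exact zero_mem _) hx hy
  refine LieAlgebra.IsSolvable.mk (R := F) (k := 3) ?_
  rw [← LieSubmodule.toSubmodule_eq_bot]
  exact le_bot_iff.mp h3

/-- Two algebras with graded bases and the same table are isomorphic. -/
lemma exists_lieEquiv {L' : Type*} [LieRing L'] [LieAlgebra F L'] {e' : ℕ → L'}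
    (h : HasTable lam e) (hb : IsGradedBasis F e) (h' : HasTable lam e')
    (hb' : IsGradedBasis F e') : ∃ φ : L ≃ₗ⁅F⁆ L', ∀ i, φ (e i) = e' i := by
  let f : L ≃ₗ[F] L' := hb.basis.equiv hb'.basis (Equiv.refl ℕ)
  have hf (i : ℕ) : f (e i) = e' i := by
    rcases i with _ | i
    · rw [hb.zero, hb'.zero, map_zero]
    · have := hb.basis.equiv_apply i hb'.basis (Equiv.refl ℕ)
      rwa [hb.basis_apply, Equiv.refl_apply, hb'.basis_apply] at this
  have hlie (x y : L) : f ⁅x, y⁆ = ⁅f x, f y⁆ := by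
    have hx : x ∈ tailSpan F e 1 := hb.tailSpan_one ▸ Submodule.mem_top
    have hy : y ∈ tailSpan F e 1 := hb.tailSpan_one ▸ Submodule.mem_top
    induction hx using Submodule.span_induction with
    | zero => simp
    | add x x' _ _ hx hx' => simp only [add_lie, map_add, hx, hx']
    | smul c x _ hx => simp only [smul_lie, map_smul, hx]
    | mem x hx =>
      obtain ⟨i, hi, rfl⟩ := hx
      induction hy using Submodule.span_induction with
      | zero => simp
      | add x x' _ _ hx hx' => simp only [lie_add, map_add, hx, hx']
      | smul c x _ hx => simp only [lie_smul, map_smul, hx]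
      | mem y hy =>
        obtain ⟨j, hj, rfl⟩ := hy
        rw [h.lie_eq hi hj, map_smul, hf, hf, hf, h'.lie_eq hi hj]
  exact ⟨{ f with map_lie' := fun {x y} => hlie x y }, hf⟩

end HasTable

lemma HasTable.of_injective {F L L' : Type*} [Field F] [LieRing L] [LieAlgebra F L] [LieRing L']
    [LieAlgebra F L'] {lam : F} {e : ℕ → L} (f : L →ₗ⁅F⁆ L') (hf : Function.Injective f)
    (h : HasTable lam fun i => f (e i)) : HasTable lam e where
  lie_one i hi := hf (by rw [LieHom.map_lie, h.lie_one i hi])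
  lie_three_two := hf (by rw [LieHom.map_lie, h.lie_three_two])
  lie_two_of_one_mod k hk := hf (by rw [LieHom.map_lie, h.lie_two_of_one_mod k hk])
  lie_two_of_two_mod k hk := hf (by
    rw [LieHom.map_lie, h.lie_two_of_two_mod k hk, _root_.map_smul])
  lie_two_of_zero_mod k hk := hf (by
    rw [LieHom.map_lie, h.lie_two_of_zero_mod k hk, _root_.map_smul])
  lie_three k hk := hf (by rw [LieHom.map_lie, h.lie_three k hk, _root_.map_smul])
  lie_eq_zero k m hk hm := hf (by rw [LieHom.map_lie, h.lie_eq_zero k m hk hm, _root_.map_zero])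

/-! ### The matrix algebra L(λ) -/

section MatrixModel

open RatFunc

variable {F : Type*} [Field F]

lemma coe_extraSeq (lam : F) (i : ℕ) :
    (extraSeq lam i : Matrix (Fin 4) (Fin 4) (RatFunc F)) =
      weightSeq (matE F) (matD lam) i := by
  rcases i with _ | _ | i
  · rfl
  · rfl
  · induction i with
    | zero => rfl
    | succ i ih =>
      change ⁅(extraSeq lam (i + 2) : Matrix (Fin 4) (Fin 4) (RatFunc F)), matE F⁆ =
        ⁅weightSeq (matE F) (matD lam) (i + 2), matE F⁆
      rw [ih]

/-- A zero column `l` kills `M * single l k c`, so the bracket is right multiplication of a row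
vector by `M`. It applies to `e_1`, `e_2`, `e_3`, whose last column is zero. -/
lemma Matrix.single_lie_of_col_eq_zero {n R : Type*} [Fintype n] [DecidableEq n] [CommRing R]
    {M : Matrix n n R} {l : n} (hM : ∀ i, M i l = 0) (k : n) (c : R) :
    ⁅Matrix.single l k c, M⁆ = Matrix.of fun i j => if i = l then c * M k j else 0 := by
  have h : M * Matrix.single l k c = 0 := by
    ext i j
    by_cases hj : j = k
    · subst hj; simp [hM]
    · simp [Matrix.mul_single_apply_of_ne, hj]
  rw [Ring.lie_def, h, sub_zero]
  ext i j
  by_cases hi : i = l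
  · subst hi; simp
  · simp [hi]

lemma matE_col_three (i : Fin 4) : matE F i 3 = 0 := by
  fin_cases i <;> simp [matE]

lemma matD_col_three (lam : F) (i : Fin 4) : matD lam i 3 = 0 := by
  fin_cases i <;> simp [matD]

/-- The matrix `e_3`. -/
noncomputable def matThree (lam : F) : Matrix (Fin 4) (Fin 4) (RatFunc F) :=
  !![C (1 - lam) * X, 0, 0, 0;
     0, C (1 - lam) * X, 0, 0;
     0, 0, C (1 - lam) * X, 0;
     0, 0, 1 / X, 0]

lemma matThree_col_three (lam : F) (i : Fin 4) : matThree lam i 3 = 0 := by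
  fin_cases i <;> simp [matThree]

lemma single_zero_lie_matE (c : RatFunc F) :
    ⁅Matrix.single (3 : Fin 4) (0 : Fin 4) c, matE F⁆ = Matrix.single 3 1 c := by
  rw [Matrix.single_lie_of_col_eq_zero matE_col_three]
  ext i j
  fin_cases i <;> fin_cases j <;> simp [matE]

lemma single_one_lie_matE (c : RatFunc F) :
    ⁅Matrix.single (3 : Fin 4) (1 : Fin 4) c, matE F⁆ = Matrix.single 3 2 c := by
  rw [Matrix.single_lie_of_col_eq_zero matE_col_three]
  ext i j
  fin_cases i <;> fin_cases j <;> simp [matE]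

lemma single_two_lie_matE (c : RatFunc F) :
    ⁅Matrix.single (3 : Fin 4) (2 : Fin 4) c, matE F⁆ = Matrix.single 3 0 (c * X) := by
  rw [Matrix.single_lie_of_col_eq_zero matE_col_three]
  ext i j
  fin_cases i <;> fin_cases j <;> simp [matE]

lemma single_zero_lie_matD (lam : F) (c : RatFunc F) :
    ⁅Matrix.single (3 : Fin 4) (0 : Fin 4) c, matD lam⁆ = Matrix.single 3 2 c := by
  rw [Matrix.single_lie_of_col_eq_zero (matD_col_three lam)]
  ext i j
  fin_cases i <;> fin_cases j <;> simp [matD]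

lemma single_one_lie_matD (lam : F) (c : RatFunc F) :
    ⁅Matrix.single (3 : Fin 4) (1 : Fin 4) c, matD lam⁆ = lam • Matrix.single 3 0 (c * X) := by
  rw [Matrix.single_lie_of_col_eq_zero (matD_col_three lam)]
  ext i j
  fin_cases i <;> fin_cases j <;>
    simp [matD, RatFunc.smul_eq_C_mul, mul_left_comm]

lemma single_two_lie_matD (lam : F) (c : RatFunc F) :
    ⁅Matrix.single (3 : Fin 4) (2 : Fin 4) c, matD lam⁆ = (-1 - lam) • Matrix.single 3 1 (c * X) := by
  rw [Matrix.single_lie_of_col_eq_zero (matD_col_three lam)]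
  ext i j
  fin_cases i <;> fin_cases j <;>
    simp [matD, RatFunc.smul_eq_C_mul]
  ring

lemma single_lie_matThree (lam : F) (k : Fin 3) (c : RatFunc F) :
    ⁅Matrix.single (3 : Fin 4) k.castSucc c, matThree lam⁆ =
      (1 - lam) • Matrix.single 3 k.castSucc (c * X) := by
  rw [Matrix.single_lie_of_col_eq_zero (matThree_col_three lam)]
  ext i j
  fin_cases k <;> fin_cases i <;> fin_cases j <;>
    simp [matThree, RatFunc.smul_eq_C_mul, mul_left_comm]

lemma single_lie_single (k l : Fin 3) (c d : RatFunc F) :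
    ⁅Matrix.single (3 : Fin 4) k.castSucc c, Matrix.single (3 : Fin 4) l.castSucc d⁆ = 0 := by
  have h (k : Fin 3) : k.castSucc ≠ (3 : Fin 4) := Fin.castSucc_ne_last k
  rw [Ring.lie_def, Matrix.single_mul_single_of_ne _ _ _ _ (h k),
    Matrix.single_mul_single_of_ne _ _ _ _ (h l), sub_zero]

lemma three_eq_zero_ratFunc [CharP F 3] : (3 : RatFunc F) = 0 := by
  rw [← map_ofNat (C (K := F)) 3, three_eq_zero_of_charP, map_zero]

/-- The diagonal coefficients come out as 1 - λ, 1 + 2λ, -2 - λ and agree only modulo 3. -/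
lemma matD_lie_matE [CharP F 3] (lam : F) : ⁅matD lam, matE F⁆ = matThree lam := by
  rw [Ring.lie_def]
  ext i j
  fin_cases i <;> fin_cases j <;>
    simp [matD, matE, matThree]
  · ring
  · linear_combination C lam * X * three_eq_zero_ratFunc (F := F)
  · linear_combination -X * three_eq_zero_ratFunc (F := F)

lemma matThree_lie_matE (lam : F) : ⁅matThree lam, matE F⁆ = Matrix.single 3 0 1 := by
  rw [Ring.lie_def]
  ext i j
  fin_cases i <;> fin_cases j <;>
    simp [matE, matThree]
  · ring
  · exact inv_mul_cancel₀ RatFunc.X_ne_zero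

lemma matThree_lie_matD [CharP F 3] (lam : F) : ⁅matThree lam, matD lam⁆ = Matrix.single 3 1 1 := by
  rw [Ring.lie_def]
  ext i j
  fin_cases i <;> fin_cases j <;>
    simp [matD, matThree]
  · ring
  · ring
  · rw [← mul_sub, ← sub_mul, mul_comm, mul_assoc, mul_inv_cancel₀ RatFunc.X_ne_zero]
    linear_combination -three_eq_zero_ratFunc (F := F)

/-- The explicit form of the matrices `e_i` with `i ≥ 4`. -/
lemma weightSeq_mat [CharP F 3] (lam : F) (j : ℕ) :
    weightSeq (matE F) (matD lam) (3 * j + 4) = Matrix.single 3 0 (X ^ j) ∧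
    weightSeq (matE F) (matD lam) (3 * j + 5) = Matrix.single 3 1 (X ^ j) ∧
    weightSeq (matE F) (matD lam) (3 * j + 6) = Matrix.single 3 2 (X ^ j) := by
  have step (n : ℕ) : weightSeq (matE F) (matD lam) (n + 3) =
    ⁅weightSeq (matE F) (matD lam) (n + 2), matE F⁆ := rfl
  have key (j : ℕ) (h : weightSeq (matE F) (matD lam) (3 * j + 4) = Matrix.single 3 0 (X ^ j)) :
      weightSeq (matE F) (matD lam) (3 * j + 4) = Matrix.single 3 0 (X ^ j) ∧
      weightSeq (matE F) (matD lam) (3 * j + 5) = Matrix.single 3 1 (X ^ j) ∧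
      weightSeq (matE F) (matD lam) (3 * j + 6) = Matrix.single 3 2 (X ^ j) := by
    have h5 : weightSeq (matE F) (matD lam) (3 * j + 5) = Matrix.single 3 1 (X ^ j) := by
      rw [step, h, single_zero_lie_matE]
    refine ⟨h, h5, ?_⟩
    rw [step, h5, single_one_lie_matE]
  induction j with
  | zero =>
    refine key 0 ?_
    rw [step, show 3 * 0 + 1 + 2 = 0 + 3 by rfl, step]
    change ⁅⁅matD lam, matE F⁆, matE F⁆ = _
    rw [matD_lie_matE, matThree_lie_matE, pow_zero]
  | succ j ih =>
    refine key (j + 1) ?_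
    rw [show 3 * (j + 1) + 4 = 3 * j + 4 + 3 by ring, step, ih.2.2, single_two_lie_matE, pow_succ]

lemma weightSeq_mat_three [CharP F 3] (lam : F) : weightSeq (matE F) (matD lam) 3 = matThree lam :=
  matD_lie_matE lam

lemma weightSeq_mat_add [CharP F 3] (lam : F) (j : ℕ) (k : Fin 3) :
    weightSeq (matE F) (matD lam) (3 * j + k + 4) = Matrix.single 3 k.castSucc (X ^ j) := by
  obtain ⟨h0, h1, h2⟩ := weightSeq_mat lam j
  fin_cases k
  · exact h0
  · exact h1
  · exact h2

lemma weightSeq_mat_of_four_le [CharP F 3] (lam : F) (i : ℕ) (hi : 4 ≤ i) : ∃ (k : Fin 3) (c : RatFunc F),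
    weightSeq (matE F) (matD lam) i = Matrix.single 3 k.castSucc c ∧
    weightSeq (matE F) (matD lam) (i + 3) = Matrix.single 3 k.castSucc (c * X) := by
  have h1 := weightSeq_mat_add lam ((i - 4) / 3) ⟨(i - 4) % 3, by omega⟩
  have h2 := weightSeq_mat_add lam ((i - 4) / 3 + 1) ⟨(i - 4) % 3, by omega⟩
  simp only at h1 h2
  rw [show 3 * ((i - 4) / 3) + (i - 4) % 3 + 4 = i by omega] at h1
  rw [show 3 * ((i - 4) / 3 + 1) + (i - 4) % 3 + 4 = i + 3 by omega, pow_succ] at h2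
  exact ⟨_, _, h1, h2⟩

lemma hasTable_mat [CharP F 3] (lam : F) : HasTable lam (weightSeq (matE F) (matD lam)) where
  lie_one := weightSeq_lie_one _ _
  lie_three_two := by
    rw [weightSeq_mat_three, (weightSeq_mat lam 0).2.1, pow_zero]
    exact matThree_lie_matD lam
  lie_two_of_one_mod k hk := by
    obtain ⟨k, rfl⟩ := Nat.exists_eq_add_of_le' hk
    obtain ⟨h0, h1, h2⟩ := weightSeq_mat lam k
    rw [show 3 * (k + 1) + 1 = 3 * k + 4 by ring, show 3 * (k + 1) + 3 = 3 * k + 6 by ring, h0, h2]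
    exact single_zero_lie_matD lam _
  lie_two_of_two_mod k hk := by
    obtain ⟨k, rfl⟩ := Nat.exists_eq_add_of_le' hk
    obtain ⟨h0, h1, h2⟩ := weightSeq_mat lam k
    rw [show 3 * (k + 1) + 2 = 3 * k + 5 by ring, h1, (weightSeq_mat lam (k + 1)).1, pow_succ]
    exact single_one_lie_matD lam _
  lie_two_of_zero_mod k hk := by
    obtain ⟨k, rfl⟩ := Nat.exists_eq_add_of_le' hk
    obtain ⟨h0, h1, h2⟩ := weightSeq_mat lam k
    rw [show 3 * (k + 1) + 3 = 3 * k + 6 by ring, h2, (weightSeq_mat lam (k + 1)).2.1, pow_succ]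
    exact single_two_lie_matD lam _
  lie_three k hk := by
    obtain ⟨l, c, h1, h2⟩ := weightSeq_mat_of_four_le lam k hk
    rw [h1, h2, weightSeq_mat_three, single_lie_matThree]
  lie_eq_zero k m hk hm := by
    obtain ⟨l, c, h1, -⟩ := weightSeq_mat_of_four_le lam k hk
    obtain ⟨l', c', h2, -⟩ := weightSeq_mat_of_four_le lam m hm
    rw [h1, h2, single_lie_single]

lemma hasTable_extraSeq [CharP F 3] (lam : F) : HasTable lam (extraSeq lam) := by
  refine HasTable.of_injective (extraAlgebra lam).incl Subtype.val_injective ?_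
  have e : (fun i => (extraAlgebra lam).incl (extraSeq lam i)) =
      weightSeq (matE F) (matD lam) := funext (coe_extraSeq lam)
  rw [e]
  exact hasTable_mat lam

/-- A linear map which takes the `e_i` to monomial vectors. -/
noncomputable def monomialMap (F : Type*) [Field F] :
    Matrix (Fin 4) (Fin 4) (RatFunc F) →ₗ[F] (Fin 3 → RatFunc F) where
  -- The factor X clears the 1/t in the fourth rows of `e_2` and `e_3`. The entry `M 0 1` detects
  -- `e_1`, whose fourth row is zero, and vanishes on the other `e_i`.
  toFun M := ![X * M 3 0 + M 0 1, X * M 3 1, X * M 3 2]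
  map_add' M N := by
    ext i
    fin_cases i <;> simp <;> ring
  map_smul' c M := by
    ext i
    fin_cases i <;> simp [RatFunc.smul_eq_C_mul] <;> ring

lemma monomialMap_weightSeq [CharP F 3] (lam : F) (j : ℕ) (k : Fin 3) :
    monomialMap F (weightSeq (matE F) (matD lam) (3 * j + k + 1)) = Pi.single k (X ^ j) := by
  have hX : (X : RatFunc F) ≠ 0 := RatFunc.X_ne_zero
  rcases j with _ | j
  · fin_cases k
    · ext l
      change monomialMap F (matE F) l = _
      fin_cases l <;> simp [monomialMap, matE]
    · ext l
      change monomialMap F (matD lam) l = _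
      fin_cases l <;> simp [monomialMap, matD, hX]
    · ext l
      change monomialMap F (weightSeq (matE F) (matD lam) 3) l = _
      rw [weightSeq_mat_three]
      fin_cases l <;> simp [monomialMap, matThree, hX]
  · rw [show 3 * (j + 1) + (k : ℕ) + 1 = 3 * j + k + 4 by ring, weightSeq_mat_add]
    ext l
    fin_cases k <;> fin_cases l <;> simp [monomialMap, pow_succ, mul_comm]

lemma linearIndependent_pow_X : LinearIndependent F fun j : ℕ => (X : RatFunc F) ^ j := by
  have h := (Polynomial.basisMonomials F).linearIndependent.map'
    (Polynomial.aeval (X : RatFunc F)).toLinearMap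
    (LinearMap.ker_eq_bot.mpr (transcendental_iff_injective.mp transcendental_X))
  have e : (Polynomial.aeval (X : RatFunc F)).toLinearMap ∘ Polynomial.basisMonomials F =
      fun j : ℕ => (X : RatFunc F) ^ j := by
    ext1 j
    simp [Polynomial.aeval_monomial]
  rwa [e] at h

lemma linearIndependent_weightSeq_mat [CharP F 3] (lam : F) :
    LinearIndependent F fun i => weightSeq (matE F) (matD lam) (i + 1) := by
  refine LinearIndependent.of_comp (monomialMap F) ?_
  have h := (Pi.linearIndependent_single (R := F) (fun (_ : Fin 3) (j : ℕ) => (X : RatFunc F) ^ j)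
    fun _ => linearIndependent_pow_X).comp
    (fun i : ℕ => (⟨⟨i % 3, by omega⟩, i / 3⟩ : Σ _ : Fin 3, ℕ)) fun i i' hi => by
      simp only [Sigma.mk.injEq, Fin.mk.injEq, heq_eq_eq] at hi
      omega
  have e : (monomialMap F ∘ fun i => weightSeq (matE F) (matD lam) (i + 1)) =
      (fun ji : Σ _ : Fin 3, ℕ => Pi.single ji.1 ((X : RatFunc F) ^ ji.2)) ∘
        fun i : ℕ => ⟨⟨i % 3, by omega⟩, i / 3⟩ := by
    ext1 i
    have := monomialMap_weightSeq lam (i / 3) ⟨i % 3, by omega⟩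
    rw [show 3 * (i / 3) + ((⟨i % 3, by omega⟩ : Fin 3) : ℕ) + 1 = i + 1 by simp only; omega] at this
    exact this
  rw [e]
  exact h

lemma isGradedBasis_extraSeq [CharP F 3] (lam : F) : IsGradedBasis F (extraSeq lam) where
  zero := rfl
  linearIndependent := by
    refine LinearIndependent.of_comp (extraAlgebra lam).toSubmodule.subtype ?_
    have e : ((extraAlgebra lam).toSubmodule.subtype ∘ fun i => extraSeq lam (i + 1)) =
        fun i => weightSeq (matE F) (matD lam) (i + 1) :=
      funext fun i => coe_extraSeq lam (i + 1)
    rw [e]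
    exact linearIndependent_weightSeq_mat lam
  span_eq_top := by
    let b := weightSeq (matE F) (matD lam)
    have hT := hasTable_mat lam
    -- By the table the span of the `e_i` is closed under brackets; containing both generators, it
    -- contains the whole algebra.
    let S : LieSubalgebra F (Matrix (Fin 4) (Fin 4) (RatFunc F)) :=
      { tailSpan F b 1 with
        lie_mem' := fun hx hy => lie_mem_of_mem_tailSpan (fun i j hi hj => by
          rw [hT.lie_eq hi hj]
          exact Submodule.smul_mem _ _ (mem_tailSpan (by omega))) hx hy }
    have hS : extraAlgebra lam ≤ S := by
      refine LieSubalgebra.lieSpan_le.mpr ?_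
      rintro x (rfl | rfl)
      · exact mem_tailSpan (F := F) (b := b) (i := 1) le_rfl
      · exact mem_tailSpan (F := F) (b := b) (i := 2) (by omega)
    rw [← top_le_iff]
    rintro ⟨x, hx⟩ -
    have hx' : x ∈ tailSpan F b 1 := hS hx
    have hmap : (Submodule.span F (Set.range fun i => extraSeq lam (i + 1))).map
        (extraAlgebra lam).toSubmodule.subtype = tailSpan F b 1 := by
      rw [Submodule.map_span, tailSpan, ← Set.range_comp]
      congr 1
      ext y
      simp only [Set.mem_range, Set.mem_image, Set.mem_Ici, Function.comp]
      constructor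
      · rintro ⟨i, rfl⟩
        exact ⟨i + 1, by omega, (coe_extraSeq lam (i + 1)).symm⟩
      · rintro ⟨i, hi, rfl⟩
        obtain ⟨i, rfl⟩ := Nat.exists_eq_add_of_le' hi
        exact ⟨i, coe_extraSeq lam (i + 1)⟩
    rw [← hmap] at hx'
    obtain ⟨y, hy, rfl⟩ := hx'
    exact hy
  lie := (hasTable_extraSeq lam).lie_exists rfl

end MatrixModel

/-! ### Normalization by rescaling, and the theorem -/

/-- Replacing `e₂` by a scalar multiple rescales all `e_i` with `i ≥ 2`. -/
lemma weightSeq_smul {F L : Type*} [Field F] [LieRing L] [LieAlgebra F L] (c : F) (e₁ e₂ : L)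
    (i : ℕ) (hi : 2 ≤ i) : weightSeq e₁ (c • e₂) i = c • weightSeq e₁ e₂ i := by
  obtain ⟨i, rfl⟩ := Nat.exists_eq_add_of_le' hi
  induction i with
  | zero => rfl
  | succ i ih =>
    change ⁅weightSeq e₁ (c • e₂) (i + 2), e₁⁆ = c • ⁅weightSeq e₁ e₂ (i + 2), e₁⁆
    rw [ih (by omega), smul_lie]

lemma IsTypeTwo.exists_normalization {F L : Type*} [Field F] [LieRing L] [LieAlgebra F L]
    {ℒ : ℕ → Submodule F L} (h : IsTypeTwo ℒ) {e₁ e₂ : L} (h₁ : e₁ ∈ ℒ 1) (h₂ : e₂ ∈ ℒ 2)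
    (hne : ⁅weightSeq e₁ e₂ 3, e₂⁆ ≠ 0) :
    ∃ (c lam : F), c ≠ 0 ∧
      ⁅weightSeq e₁ (c • e₂) 3, c • e₂⁆ = weightSeq e₁ (c • e₂) 5 ∧
      ⁅weightSeq e₁ (c • e₂) 5, c • e₂⁆ = lam • weightSeq e₁ (c • e₂) 7 := by
  have n₂ : e₂ ≠ 0 := by
    rintro rfl
    exact hne (lie_zero _)
  have n₁ : e₁ ≠ 0 := by
    rintro rfl
    refine hne ?_
    change ⁅⁅e₂, (0 : L)⁆, e₂⁆ = 0
    rw [lie_zero, zero_lie]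
  have hb := h.isGradedBasis_weightSeq h₁ h₂ n₁ n₂
  obtain ⟨α, hα⟩ : ∃ α : F, ⁅weightSeq e₁ e₂ 3, e₂⁆ = α • weightSeq e₁ e₂ 5 := hb.lie 3 2
  obtain ⟨β, hβ⟩ : ∃ β : F, ⁅weightSeq e₁ e₂ 5, e₂⁆ = β • weightSeq e₁ e₂ 7 := hb.lie 5 2
  have hα0 : α ≠ 0 := by
    rintro rfl
    rw [zero_smul] at hα
    exact hne hα
  -- `[e_3, e_2]` and `[e_5, e_2]` are quadratic in `e_2`, while `e_5` and `e_7` are linear, so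
  -- scaling `e_2` by c multiplies α and β by c.
  refine ⟨α⁻¹, α⁻¹ * β, inv_ne_zero hα0, ?_, ?_⟩
  · rw [weightSeq_smul _ _ _ 3 (by omega), weightSeq_smul _ _ _ 5 (by omega), smul_lie, lie_smul,
      hα, inv_smul_smul₀ hα0]
  · rw [weightSeq_smul _ _ _ 5 (by omega), weightSeq_smul _ _ _ 7 (by omega), smul_lie, lie_smul,
      hβ, smul_smul, smul_smul, smul_smul]
    congr 1
    ring

theorem mainTheorem7 {F : Type*} [Field F] [CharP F 3] :
    -- for each `lam`, existence, properties and uniqueness of the algebra with parameter `lam`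
    (∀ lam : F,
      -- the algebra generated by the two matrices is a soluble algebra of type 2
      (IsTypeTwo (extraGrading lam) ∧
        ¬ Module.Finite F (extraAlgebra lam) ∧
        LieAlgebra.IsSolvable (extraAlgebra lam) ∧
        -- the `e_i`, `i ≥ 1`, are a basis and satisfy the multiplication table
        LinearIndependent F (fun i : ℕ => extraSeq lam (i + 1)) ∧
        Submodule.span F (Set.range fun i : ℕ => extraSeq lam (i + 1)) = ⊤ ∧
        HasTable lam (extraSeq lam) ∧
        -- the `e_i`, `i ≥ 3`, as explicit matrices
        (extraSeq lam 3 : Matrix (Fin 4) (Fin 4) (RatFunc F)) =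
          !![RatFunc.C (1 - lam) * RatFunc.X, 0, 0, 0;
             0, RatFunc.C (1 - lam) * RatFunc.X, 0, 0;
             0, 0, RatFunc.C (1 - lam) * RatFunc.X, 0;
             0, 0, 1 / RatFunc.X, 0] ∧
        (∀ (j : ℕ) (k : Fin 3),
          (extraSeq lam (3 * (j + 1) + (k + 1)) : Matrix (Fin 4) (Fin 4) (RatFunc F)) =
            Matrix.single (3 : Fin 4) k.castSucc (RatFunc.X ^ j))) ∧
      -- every algebra of type 2 with `[e_3, e_2] = e_5` and `[e_5, e_2] = lam e_7` satisfies the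
      -- multiplication table and is isomorphic to it as a graded Lie algebra
      (∀ (L : Type*) [LieRing L] [LieAlgebra F L] (ℒ : ℕ → Submodule F L), IsTypeTwo ℒ →
        ∀ e₁ ∈ ℒ 1, ∀ e₂ ∈ ℒ 2, e₁ ≠ 0 → e₂ ≠ 0 →
          ⁅weightSeq e₁ e₂ 3, e₂⁆ = weightSeq e₁ e₂ 5 →
          ⁅weightSeq e₁ e₂ 5, e₂⁆ = lam • weightSeq e₁ e₂ 7 →
          HasTable lam (weightSeq e₁ e₂) ∧
          ∃ φ : L ≃ₗ⁅F⁆ extraAlgebra lam,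
            (∀ i : ℕ, φ (weightSeq e₁ e₂ i) = extraSeq lam i) ∧
            (∀ i : ℕ, (ℒ i).map (φ : L →ₗ[F] extraAlgebra lam) = extraGrading lam i))) ∧
    -- every algebra of type 2 with `[e_3, e_2] ≠ 0` is of this kind after rescaling `e_2`
    (∀ (L : Type*) [LieRing L] [LieAlgebra F L] (ℒ : ℕ → Submodule F L), IsTypeTwo ℒ →
      ∀ e₁ ∈ ℒ 1, ∀ e₂ ∈ ℒ 2, ⁅weightSeq e₁ e₂ 3, e₂⁆ ≠ 0 →
        ∃ (c lam : F), c ≠ 0 ∧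
          ⁅weightSeq e₁ (c • e₂) 3, c • e₂⁆ = weightSeq e₁ (c • e₂) 5 ∧
          ⁅weightSeq e₁ (c • e₂) 5, c • e₂⁆ = lam • weightSeq e₁ (c • e₂) 7) := by

  refine ⟨fun lam => ⟨?_, ?_⟩, fun L _ _ ℒ hL e₁ h₁ e₂ h₂ hne =>
    hL.exists_normalization h₁ h₂ hne⟩
  · have hT := hasTable_extraSeq lam
    have hb := isGradedBasis_extraSeq lam
    refine ⟨hT.isTypeTwo hb, fun hfin => ?_, hT.isSolvable hb, hb.linearIndependent,
      hb.span_eq_top, hT, ?_, fun j k => ?_⟩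
    · exact not_finite_iff_infinite.mpr (inferInstanceAs (Infinite ℕ))
        (hb.linearIndependent.finite)
    · rw [coe_extraSeq, weightSeq_mat_three]
      rfl
    · rw [coe_extraSeq, show 3 * (j + 1) + ((k : ℕ) + 1) = 3 * j + k + 4 by ring,
        weightSeq_mat_add]
  · intro L _ _ ℒ hL e₁ h₁ e₂ h₂ n₁ n₂ h3 h5
    have hb := hL.isGradedBasis_weightSeq h₁ h₂ n₁ n₂
    have hT := hb.hasTable (weightSeq_lie_one e₁ e₂) h3 h5
    obtain ⟨φ, hφ⟩ := hT.exists_lieEquiv hb (hasTable_extraSeq lam) (isGradedBasis_extraSeq lam)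
    refine ⟨hT, φ, hφ, fun i => ?_⟩
    rw [hL.eq_span_singleton hb.zero (hL.weightSeq_mem h₁ h₂)
      (hL.weightSeq_ne_zero h₁ h₂ n₁ n₂) i, Submodule.map_span, Set.image_singleton]
    exact congrArg (fun x => Submodule.span F {x}) (hφ i)
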